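/- Let $I=[0,\alpha)$ with $\alpha=1$ or $\alpha=\infty$, equipped with Lebesgue measure $\mu$, and let $L^0$ be the space of ($\mu$-a.e. equivalence classes of) measurable, a.e. finite functions on $I$. For $x\in L^0$ put $$d_x(\lambda)=\mu\{s\in I:|x(s)|>\lambda\}\ (\lambda\ge 0),\qquad x^*(t)=\inf\{\lambda>0:d_x(\lambda)\le t\}\ (t\ge 0),\qquad x^{**}(t)=\frac1t\int_0^t x^*(s)\,ds\ (t>0),$$ and write $x\prec y$ if $x^{**}(t)\le y^{**}(t)$ for all $t>0$. Let $E$ be a symmetric space on $I$. That is, $E$ is a linear subspace of $L^0$ with a complete norm $\|\cdot\|_E$ such that: (a) if $x\in L^0$, $y\in E$ and $|x|\le|y|$ a.e., then $x\in E$ and $\|x\|_E\le\|y\|_E$; (b) $E$ contains an a.e. strictly positive function; (c) if $x\in L^0$, $y\in E$ and $d_x=d_y$, then $x\in E$ and $\|x\|_E=\|y\|_E$. (The Fatou property is not assumed.) Let $\phi(t)=\|\chi_{(0,t)}\|_E$ be the fundamental function of $E$. Call $E$ order continuous if, for every $x\in E$ and every sequence $(x_n)\subset E$ with $0\le x_n\le|x|$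 and $x_n\to 0$ a.e., one has $\|x_n\|_E\to 0$. Call $E$ $K$-order continuous if, for every $x\in E$ and every sequence $(x_n)\subset E$ with $x_n\prec x$ and $x_n^*\to 0$ a.e. on $I$, one has $\|x_n\|_E\to 0$. Then the following conditions are equivalent. (i) $E$ is order continuous and, in case $\alpha=\infty$, for every $x\in E$, $\phi(s)x^{**}(s)\to 0$ as $s\to\infty$. (ii) $E$ is $K$-order continuous and, in case $\alpha=\infty$, for every $x\in E$, $x^*(\infty):=\lim_{t\to\infty}x^*(t)=0$. -/

import Mathlib

open MeasureTheory Filter Topology Set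
open scoped ENNReal

noncomputable section

namespace SymmetricSpace

/-- Lebesgue measure on the interval `I = [0, α)`, regarded as a measure on `ℝ`. -/
def intervalMeasure (α : ℝ≥0∞) : Measure ℝ :=
  volume.restrict {s : ℝ | 0 ≤ s ∧ ENNReal.ofReal s < α}

/-- `L⁰(I)`: a.e.-equivalence classes of (a.e. finite) measurable functions on `I = [0, α)`. -/
abbrev L0 (α : ℝ≥0∞) : Type := ℝ →ₘ[intervalMeasure α] ℝ

variable {α : ℝ≥0∞}

/-- The distribution function `d_x(l) = μ {s ∈ I : |x s| > l}`. -/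
def distribution (x : L0 α) (l : ℝ≥0∞) : ℝ≥0∞ :=
  intervalMeasure α {s | l < ‖x s‖ₑ}

/-- The decreasing rearrangement `x*(t) = inf {l > 0 : d_x(l) ≤ t}`, for `t ≥ 0`. -/
def rearrangement (x : L0 α) (t : ℝ) : ℝ≥0∞ :=
  sInf {l : ℝ≥0∞ | 0 < l ∧ distribution x l ≤ ENNReal.ofReal t}

/-- The maximal function `x**(t) = (1/t) ∫₀ᵗ x*(s) ds`, for `t > 0`. -/
def maximal (x : L0 α) (t : ℝ) : ℝ≥0∞ :=
  (∫⁻ s in Ioo 0 t, rearrangement x s) / ENNReal.ofReal t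

/-- `x` and `y` are equimeasurable: `d_x = d_y`. -/
def Equimeasurable (x y : L0 α) : Prop :=
  distribution x = distribution y

/-- The Hardy-Littlewood-Pólya relation `x ≺ y`: `x**(t) ≤ y**(t)` for all `t > 0`. -/
def HLP (x y : L0 α) : Prop :=
  ∀ t : ℝ, 0 < t → maximal x t ≤ maximal y t

/-- The class in `L⁰(I)` of the indicator function of `(0, t)`. -/
def chi (α : ℝ≥0∞) (t : ℝ) : L0 α :=
  AEEqFun.mk ((Ioo 0 t).indicator fun _ => (1 : ℝ))
    ((measurable_const.indicator measurableSet_Ioo).aestronglyMeasurable)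

/-- A Banach function space (Köthe space) on `I = [0, α)`: a linear subspace of `L⁰(I)` with a
complete norm, which is an order ideal with monotone norm and contains a strictly positive
element. -/
structure BanachFunctionSpace (α : ℝ≥0∞) where
  /-- the elements of the space -/
  carrier : Submodule ℝ (L0 α)
  /-- the norm -/
  toNorm : Norm carrier
  core : NormedSpace.Core ℝ carrier
  complete :
    letI : NormedAddCommGroup carrier := NormedAddCommGroup.ofCore core
    CompleteSpace carrier
  solid : ∀ (x : L0 α) (y : carrier), (|x| ≤ |(y : L0 α)|) →
    ∃ hx : x ∈ carrier, ‖(⟨x, hx⟩ : carrier)‖ ≤ ‖y‖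
  exists_pos : ∃ x : carrier, ∀ᵐ s ∂(intervalMeasure α), 0 < (x : L0 α) s

namespace BanachFunctionSpace

instance (E : BanachFunctionSpace α) : NormedAddCommGroup E.carrier :=
  letI := E.toNorm
  NormedAddCommGroup.ofCore E.core

instance (E : BanachFunctionSpace α) : NormedSpace ℝ E.carrier :=
  letI := E.toNorm
  NormedSpace.ofCore E.core

instance (E : BanachFunctionSpace α) : CompleteSpace E.carrier := E.complete

/-- `E` is symmetric (rearrangement invariant). -/
def IsSymmetric (E : BanachFunctionSpace α) : Prop :=
  ∀ (x : L0 α) (y : E.carrier), Equimeasurable x (y : L0 α) →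
    ∃ hx : x ∈ E.carrier, ‖(⟨x, hx⟩ : E.carrier)‖ = ‖y‖

open scoped Classical in
/-- The norm of `E` extended to `L⁰(I)` by the value `∞` outside `E`. -/
def extNorm (E : BanachFunctionSpace α) (x : L0 α) : ℝ≥0∞ :=
  if hx : x ∈ E.carrier then ‖(⟨x, hx⟩ : E.carrier)‖ₑ else ⊤

/-- The fundamental function `φ_E(t) = ‖χ_(0,t)‖_E`. -/
def fundamental (E : BanachFunctionSpace α) (t : ℝ) : ℝ≥0∞ :=
  E.extNorm (chi α t)

/-- `x` is a point of order continuity of `E`. -/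
def IsOCPoint (E : BanachFunctionSpace α) (x : E.carrier) : Prop :=
  ∀ u : ℕ → E.carrier,
    (∀ n, 0 ≤ (u n : L0 α)) →
    (∀ n, (u n : L0 α) ≤ |(x : L0 α)|) →
    (∀ᵐ s ∂(intervalMeasure α), Tendsto (fun n => (u n : L0 α) s) atTop (𝓝 0)) →
    Tendsto (fun n => ‖u n‖) atTop (𝓝 0)

/-- `E` is order continuous. -/
def OrderContinuous (E : BanachFunctionSpace α) : Prop :=
  ∀ x : E.carrier, E.IsOCPoint x

/-- `x` is a point of `K`-order continuity of `E`. -/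
def IsKOCPoint (E : BanachFunctionSpace α) (x : E.carrier) : Prop :=
  ∀ u : ℕ → E.carrier,
    (∀ n, HLP (u n : L0 α) (x : L0 α)) →
    (∀ᵐ t ∂(intervalMeasure α),
      Tendsto (fun n => rearrangement (u n : L0 α) t) atTop (𝓝 0)) →
    Tendsto (fun n => ‖u n‖) atTop (𝓝 0)

/-- `E` is `K`-order continuous. -/
def KOrderContinuous (E : BanachFunctionSpace α) : Prop :=
  ∀ x : E.carrier, E.IsKOCPoint x

end BanachFunctionSpace

end SymmetricSpace

end

noncomputable section

namespace SymmetricSpace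

variable {α : ℝ≥0∞}

/-! The norm is extended to arbitrary `[0,∞]`-valued functions (`funNorm`), so that rearrangements
can be measured without checking that they define classes in the space. Symmetry then gives
monotonicity with respect to distribution functions (`funNorm_le_of_distr_le`), and the norm of `x`
is the norm of its rearrangement.

The main obstacle is that `g ≺ f` does not by itself yield a norm inequality in a symmetric space
without the Fatou property. It does for step functions on cells of equal length: a norming
functional for the smaller function, combined with the rearrangement inequality and Abel summation,
reduces the claim to permutation invariance (`funNorm_step_le_of_sum_le`). Discretizing decreasing
functions by cell averages costs one extra cell near the origin, which the estimate `φ(t) f**(t) ≤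
‖f‖` (`fundamental_mul_lintegral_le`) controls. Hence `‖g‖ ≤ 2‖f‖` for truncations of `g` away from
the ends of the interval, and order continuity removes the truncation
(`OrderContinuous.funNorm_le_two_mul`).

For (i) ⇒ (ii), cut `u_n*` at `a < b`. The head is at most twice the head of `x*`, small by order
continuity; the middle is at most `u_n*(a) φ(b)`, which tends to zero. The tail, translated to the
origin, is majorized by `x*` with its values on `(0,b)` replaced by the average `x**(b)`; the norm
of this function is at most `φ(b) x**(b) + ‖x* χ_[b,∞)‖`, small by both parts of (i). The condition
`x*(∞) = 0` follows from `φ(1) x*(s) ≤ φ(s) x**(s)` for `s ≥ 1`.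

For (ii) ⇒ (i), domination together with `x*(∞) = 0` turns a.e. convergence into convergence in
measure, hence into convergence of rearrangements. The decay of `φ x**` comes from applying
`K`-order continuity to the functions `x**(s) χ_(0,s) ≺ x`. -/

/-! ### Distribution functions and decreasing rearrangements of extended functions -/

/-- The distribution function of an extended nonnegative function on `[0, α)`. -/
def distr (α : ℝ≥0∞) (f : ℝ → ℝ≥0∞) (l : ℝ≥0∞) : ℝ≥0∞ :=
  intervalMeasure α {s | l < f s}

/-- The decreasing rearrangement of an extended nonnegative function on `[0, α)`. -/
def decr (α : ℝ≥0∞) (f : ℝ → ℝ≥0∞) (t : ℝ) : ℝ≥0∞ :=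
  sInf {l : ℝ≥0∞ | 0 < l ∧ distr α f l ≤ ENNReal.ofReal t}

theorem rearrangement_eq_decr (x : L0 α) : rearrangement x = decr α (fun s => ‖x s‖ₑ) := rfl

theorem distribution_eq_distr (x : L0 α) : distribution x = distr α (fun s => ‖x s‖ₑ) := rfl

theorem measurableSet_interval (c : ℝ≥0∞) :
    MeasurableSet {s : ℝ | 0 ≤ s ∧ ENNReal.ofReal s < c} :=
  measurableSet_Ici.inter (measurableSet_lt ENNReal.measurable_ofReal measurable_const)

theorem volume_interval (c : ℝ≥0∞) : volume {s : ℝ | 0 ≤ s ∧ ENNReal.ofReal s < c} = c := by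
  induction c with
  | top =>
    have : {s : ℝ | 0 ≤ s ∧ ENNReal.ofReal s < ⊤} = Ici 0 := by
      ext s; simp
    rw [this, Real.volume_Ici]
  | coe c =>
    have : {s : ℝ | 0 ≤ s ∧ ENNReal.ofReal s < c} = Ico 0 (c : ℝ) := by
      ext s
      simp only [mem_ofPred_eq, mem_Ico, and_congr_right_iff]
      intro hs
      rw [← ENNReal.ofReal_coe_nnreal, ENNReal.ofReal_lt_ofReal_iff_of_nonneg hs]
    rw [this, Real.volume_Ico]
    simp

theorem ae_interval : ∀ᵐ s ∂(intervalMeasure α), 0 < s ∧ ENNReal.ofReal s < α := by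
  have h1 : ∀ᵐ s ∂(intervalMeasure α), 0 ≤ s ∧ ENNReal.ofReal s < α :=
    ae_restrict_mem (measurableSet_interval α)
  have h2 : ∀ᵐ s ∂(intervalMeasure α), s ≠ 0 :=
    ae_restrict_of_ae (Measure.ae_ne volume 0)
  filter_upwards [h1, h2] with s hs hs'
  exact ⟨lt_of_le_of_ne hs.1 hs'.symm, hs.2⟩

theorem intervalMeasure_univ : intervalMeasure α univ = α := by
  simp only [intervalMeasure, Measure.restrict_apply_univ, volume_interval]

theorem distr_antitone (f : ℝ → ℝ≥0∞) : Antitone (distr α f) := fun _ _ h =>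
  measure_mono fun _ hs => lt_of_le_of_lt h hs

theorem distr_mono {f g : ℝ → ℝ≥0∞} (h : f ≤ᵐ[intervalMeasure α] g) : distr α f ≤ distr α g :=
  fun _ => measure_mono_ae (h.mono fun _ hs hl => lt_of_lt_of_le hl hs)

theorem distr_congr {f g : ℝ → ℝ≥0∞} (h : f =ᵐ[intervalMeasure α] g) : distr α f = distr α g :=
  le_antisymm (distr_mono h.le) (distr_mono h.symm.le)

theorem decr_mono {f g : ℝ → ℝ≥0∞} (h : distr α f ≤ distr α g) : decr α f ≤ decr α g :=
  fun _ => sInf_le_sInf fun l hl => ⟨hl.1, (h l).trans hl.2⟩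

theorem decr_antitone (f : ℝ → ℝ≥0∞) : Antitone (decr α f) := fun _ _ h =>
  sInf_le_sInf fun _ hl => ⟨hl.1, hl.2.trans (ENNReal.ofReal_le_ofReal h)⟩

/-- This is the Galois connection between the two generalized inverses. It rests on right continuity
of the distribution function: the set where `f > l` is the increasing union of the sets where `f > v
n`, for `v n` decreasing to `l`. -/
theorem lt_decr_iff (f : ℝ → ℝ≥0∞) (l : ℝ≥0∞) (t : ℝ) :
    l < decr α f t ↔ ENNReal.ofReal t < distr α f l := by
  constructor
  · intro h
    by_contra! h'
    refine absurd h (not_lt.2 ?_)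
    refine le_of_forall_gt_imp_ge_of_dense fun m hm => sInf_le ⟨bot_le.trans_lt hm, ?_⟩
    exact (distr_antitone f hm.le).trans h'
  · intro h
    have hl : l ≠ ⊤ := by
      rintro rfl
      simp [distr] at h
    obtain ⟨v, hv, hvl, hvt⟩ := exists_seq_strictAnti_tendsto' (lt_top_iff_ne_top.2 hl)
    have hU : {s | l < f s} = ⋃ n, {s | v n < f s} := by
      ext s
      simp only [mem_ofPred_eq, mem_iUnion]
      constructor
      · intro hs
        exact ((tendsto_order.1 hvt).2 _ hs).exists
      · rintro ⟨n, hn⟩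
        exact (hvl n).1.trans hn
    have hmono : Monotone fun n => {s | v n < f s} := fun a b hab s hs =>
      lt_of_le_of_lt (hv.antitone hab) hs
    have := hmono.measure_iUnion (μ := intervalMeasure α)
    rw [← hU] at this
    rw [distr, this, lt_iSup_iff] at h
    obtain ⟨n, hn⟩ := h
    refine (hvl n).1.trans_le (le_sInf fun m hm => ?_)
    by_contra! h'
    exact absurd (hm.2.trans_lt hn) (not_lt.2 (distr_antitone f h'.le))

theorem decr_le_iff (f : ℝ → ℝ≥0∞) (l : ℝ≥0∞) (t : ℝ) :
    decr α f t ≤ l ↔ distr α f l ≤ ENNReal.ofReal t := by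
  rw [← not_lt, lt_decr_iff, not_lt]

theorem distr_le (f : ℝ → ℝ≥0∞) (l : ℝ≥0∞) : distr α f l ≤ α :=
  (measure_mono (subset_univ _)).trans_eq intervalMeasure_univ

/-- By `lt_decr_iff`, the superlevel set of the rearrangement at height `l` is an initial interval
of length `distr α f l`. -/
theorem distr_decr (f : ℝ → ℝ≥0∞) : distr α (decr α f) = distr α f := by
  funext l
  have hm : MeasurableSet {s | l < decr α f s} :=
    measurableSet_lt measurable_const (decr_antitone f).measurable
  rw [distr, intervalMeasure, Measure.restrict_apply hm]
  have : {s | l < decr α f s} ∩ {s : ℝ | 0 ≤ s ∧ ENNReal.ofReal s < α}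
      = {s : ℝ | 0 ≤ s ∧ ENNReal.ofReal s < distr α f l} := by
    ext s
    simp only [mem_inter_iff, mem_ofPred_eq, lt_decr_iff]
    constructor
    · rintro ⟨h1, h2, h3⟩
      exact ⟨h2, h1⟩
    · rintro ⟨h2, h1⟩
      exact ⟨h1, h2, h1.trans_le (distr_le f l)⟩
  rw [this, volume_interval]

/-- Translation to the right does not increase the distribution function. -/
theorem distr_shift_le {f : ℝ → ℝ≥0∞} (hf : Measurable f) {h : ℝ} (hh : 0 ≤ h) :
    distr α ((Ici h).indicator fun s => f (s - h)) ≤ distr α f := by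
  intro l
  have hm : Measurable ((Ici h).indicator fun s => f (s - h)) :=
    (hf.comp (measurable_id.sub_const h)).indicator measurableSet_Ici
  rw [distr, distr, intervalMeasure,
    Measure.restrict_apply (measurableSet_lt measurable_const hm),
    Measure.restrict_apply (measurableSet_lt measurable_const hf),
    ← measure_preimage_add_right volume (-h) ({s | l < f s} ∩ _)]
  refine measure_mono ?_
  rintro s ⟨hs, hs0, hsα⟩
  simp only [mem_ofPred_eq, indicator_apply, mem_Ici] at hs
  split_ifs at hs with hsh
  · rw [sub_eq_add_neg] at hs
    refine ⟨hs, ?_, lt_of_le_of_lt (ENNReal.ofReal_le_ofReal ?_) hsα⟩ <;> linarith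
  · simp at hs

/-- The class in `L⁰` of an extended nonnegative function. -/
def ofFun (α : ℝ≥0∞) (f : ℝ → ℝ≥0∞) (hf : Measurable f) : L0 α :=
  AEEqFun.mk (fun s => (f s).toReal) hf.ennreal_toReal.aestronglyMeasurable

theorem enorm_ofFun {f : ℝ → ℝ≥0∞} (hf : Measurable f)
    (hf' : ∀ᵐ s ∂(intervalMeasure α), f s ≠ ⊤) :
    (fun s => ‖ofFun α f hf s‖ₑ) =ᵐ[intervalMeasure α] f := by
  filter_upwards [AEEqFun.coeFn_mk (fun s => (f s).toReal)
    hf.ennreal_toReal.aestronglyMeasurable, hf'] with s hs hs'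
  rw [ofFun, hs, Real.enorm_eq_ofReal ENNReal.toReal_nonneg, ENNReal.ofReal_toReal hs']

theorem enorm_le_enorm_iff {x y : L0 α} :
    |x| ≤ |y| ↔ (fun s => ‖x s‖ₑ) ≤ᵐ[intervalMeasure α] fun s => ‖y s‖ₑ := by
  rw [← AEEqFun.coeFn_le]
  have h1 := AEEqFun.coeFn_abs x
  have h2 := AEEqFun.coeFn_abs y
  constructor
  · intro h
    filter_upwards [h, h1, h2] with s hs h1 h2
    rw [h1, h2] at hs
    rw [enorm_le_iff_norm_le]
    exact hs
  · intro h
    filter_upwards [h, h1, h2] with s hs h1 h2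
    rw [h1, h2]
    rw [enorm_le_iff_norm_le] at hs
    exact hs

theorem measurable_enorm_coe (x : L0 α) : Measurable fun s => ‖x s‖ₑ :=
  x.measurable.enorm

/-! ### The norm extended to nonnegative functions -/

namespace BanachFunctionSpace

/-- The function norm on extended nonnegative functions induced by `E`. -/
def funNorm (E : BanachFunctionSpace α) (f : ℝ → ℝ≥0∞) : ℝ≥0∞ :=
  ⨅ (x : E.carrier) (_ : f ≤ᵐ[intervalMeasure α] fun s => ‖(x : L0 α) s‖ₑ), ‖x‖ₑ

variable (E : BanachFunctionSpace α)

theorem enorm_le_of_ae_le {x y : E.carrier}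
    (h : (fun s => ‖(x : L0 α) s‖ₑ) ≤ᵐ[intervalMeasure α] fun s => ‖(y : L0 α) s‖ₑ) :
    ‖x‖ₑ ≤ ‖y‖ₑ := by
  obtain ⟨_, h⟩ := E.solid x y (enorm_le_enorm_iff.2 h)
  rw [enorm_le_iff_norm_le]
  exact h

theorem mem_of_ae_le {x : L0 α} {y : E.carrier}
    (h : (fun s => ‖x s‖ₑ) ≤ᵐ[intervalMeasure α] fun s => ‖(y : L0 α) s‖ₑ) : x ∈ E.carrier :=
  (E.solid x y (enorm_le_enorm_iff.2 h)).1

theorem funNorm_le {f : ℝ → ℝ≥0∞} (x : E.carrier)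
    (h : f ≤ᵐ[intervalMeasure α] fun s => ‖(x : L0 α) s‖ₑ) : E.funNorm f ≤ ‖x‖ₑ :=
  iInf₂_le x h

theorem funNorm_mono {f g : ℝ → ℝ≥0∞} (h : f ≤ᵐ[intervalMeasure α] g) :
    E.funNorm f ≤ E.funNorm g :=
  le_iInf₂ fun x hx => E.funNorm_le x (h.trans hx)

theorem funNorm_coe (x : E.carrier) : E.funNorm (fun s => ‖(x : L0 α) s‖ₑ) = ‖x‖ₑ :=
  le_antisymm (E.funNorm_le x EventuallyLE.rfl) (le_iInf₂ fun _ hy => E.enorm_le_of_ae_le hy)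

theorem exists_of_funNorm_lt {f : ℝ → ℝ≥0∞} {c : ℝ≥0∞} (h : E.funNorm f < c) :
    ∃ x : E.carrier, (f ≤ᵐ[intervalMeasure α] fun s => ‖(x : L0 α) s‖ₑ) ∧ ‖x‖ₑ < c := by
  simpa [funNorm, iInf_lt_iff] using h

theorem funNorm_enorm (x : L0 α) : E.funNorm (fun s => ‖x s‖ₑ) = E.extNorm x := by
  by_cases hx : x ∈ E.carrier
  · rw [extNorm, dif_pos hx, ← E.funNorm_coe]
  · rw [extNorm, dif_neg hx]
    by_contra h
    obtain ⟨y, hy, -⟩ := E.exists_of_funNorm_lt (lt_top_iff_ne_top.2 h)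
    exact hx (E.mem_of_ae_le hy)

theorem mem_of_funNorm_lt_top {x : L0 α} (h : E.funNorm (fun s => ‖x s‖ₑ) < ⊤) :
    x ∈ E.carrier := by
  obtain ⟨y, hy, -⟩ := E.exists_of_funNorm_lt h
  exact E.mem_of_ae_le hy

theorem ae_ne_top_of_funNorm_lt_top {f : ℝ → ℝ≥0∞} (h : E.funNorm f < ⊤) :
    ∀ᵐ s ∂(intervalMeasure α), f s ≠ ⊤ := by
  obtain ⟨y, hy, -⟩ := E.exists_of_funNorm_lt h
  filter_upwards [hy] with s hs
  exact (hs.trans_lt enorm_lt_top).ne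

theorem enorm_abs_ae (x : L0 α) :
    (fun s => ‖(|x|) s‖ₑ) =ᵐ[intervalMeasure α] fun s => ‖x s‖ₑ := by
  filter_upwards [AEEqFun.coeFn_abs x] with s hs
  rw [hs, Real.enorm_abs]

theorem abs_mem (x : E.carrier) : |(x : L0 α)| ∈ E.carrier :=
  E.mem_of_ae_le (enorm_abs_ae _).le

theorem enorm_abs (x : E.carrier) : ‖(⟨_, E.abs_mem x⟩ : E.carrier)‖ₑ = ‖x‖ₑ :=
  le_antisymm (E.enorm_le_of_ae_le (enorm_abs_ae _).le)
    (E.enorm_le_of_ae_le (enorm_abs_ae _).symm.le)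

theorem funNorm_add_le (f g : ℝ → ℝ≥0∞) :
    E.funNorm (fun s => f s + g s) ≤ E.funNorm f + E.funNorm g := by
  refine ENNReal.le_iInf₂_add_iInf₂ fun x hx y hy => ?_
  let x' : E.carrier := ⟨_, E.abs_mem x⟩
  let y' : E.carrier := ⟨_, E.abs_mem y⟩
  refine (E.funNorm_le (x' + y') ?_).trans ((enorm_add_le x' y').trans_eq ?_)
  · filter_upwards [hx, hy, AEEqFun.coeFn_add (x' : L0 α) (y' : L0 α),
      AEEqFun.coeFn_abs (x : L0 α), AEEqFun.coeFn_abs (y : L0 α)] with s h1 h2 h3 h4 h5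
    change _ ≤ ‖((x' : L0 α) + (y' : L0 α)) s‖ₑ
    rw [h3, Pi.add_apply]
    change _ ≤ ‖|(x : L0 α)| s + |(y : L0 α)| s‖ₑ
    rw [h4, h5, Real.enorm_eq_ofReal (by positivity),
      ENNReal.ofReal_add (abs_nonneg _) (abs_nonneg _)]
    rw [← ofReal_norm] at h1 h2
    exact add_le_add h1 h2
  · rw [E.enorm_abs, E.enorm_abs]

theorem funNorm_zero : E.funNorm (fun _ => 0) = 0 := by
  have := E.funNorm_le (f := fun _ => 0) 0 (Eventually.of_forall fun s => zero_le)
  simpa using this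

theorem funNorm_sum_le {ι : Type*} (S : Finset ι) (f : ι → ℝ → ℝ≥0∞) :
    E.funNorm (fun s => ∑ i ∈ S, f i s) ≤ ∑ i ∈ S, E.funNorm (f i) := by
  classical
  induction S using Finset.induction_on with
  | empty => simp [funNorm_zero]
  | insert i S hi ih =>
    simp only [Finset.sum_insert hi]
    exact (E.funNorm_add_le _ _).trans (add_le_add le_rfl ih)

theorem funNorm_mul_le (c : NNReal) (f : ℝ → ℝ≥0∞) :
    E.funNorm (fun s => c * f s) ≤ c * E.funNorm f := by
  rcases eq_or_ne c 0 with rfl | hc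
  · simp [funNorm_zero]
  rw [funNorm, funNorm, ENNReal.mul_iInf_of_ne (by simpa using hc) (by simp)]
  refine le_iInf fun x => ?_
  rw [ENNReal.mul_iInf_of_ne (by simpa using hc) (by simp)]
  refine le_iInf fun hx => ?_
  refine (E.funNorm_le ((c : ℝ) • x) ?_).trans_eq ?_
  · filter_upwards [hx, AEEqFun.coeFn_smul (c : ℝ) (x : L0 α)] with s h1 h2
    change _ ≤ ‖((c : ℝ) • (x : L0 α)) s‖ₑ
    rw [h2, Pi.smul_apply, enorm_smul]
    simpa using mul_le_mul_right h1 _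
  · rw [enorm_smul]
    simp

/-- Finite scalars follow by applying `funNorm_mul_le` to the inverse; an infinite scalar is the
supremum of the naturals. The infinite case matters because step coefficients are allowed to be
infinite. -/
theorem mul_funNorm_le (c : ℝ≥0∞) (f : ℝ → ℝ≥0∞) :
    c * E.funNorm f ≤ E.funNorm (fun s => c * f s) := by
  have key : ∀ b : NNReal, (b : ℝ≥0∞) ≤ c → b * E.funNorm f ≤ E.funNorm (fun s => c * f s) := by
    intro b hb
    rcases eq_or_ne b 0 with rfl | hb0
    · simp
    have h1 : E.funNorm f ≤ (b⁻¹ : NNReal) * E.funNorm (fun s => c * f s) := by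
      refine le_trans (E.funNorm_mono (Eventually.of_forall fun s => ?_)) (E.funNorm_mul_le _ _)
      have : f s = (b⁻¹ : NNReal) * (b * f s) := by
        rw [← mul_assoc, ← ENNReal.coe_mul, inv_mul_cancel₀ hb0]
        simp
      exact this.trans_le (by gcongr)
    calc b * E.funNorm f ≤ b * ((b⁻¹ : NNReal) * E.funNorm (fun s => c * f s)) := by gcongr
      _ = _ := by
        rw [← mul_assoc, ← ENNReal.coe_mul, mul_inv_cancel₀ hb0]
        simp
  induction c with
  | coe b => exact key b le_rfl
  | top =>
    rw [← ENNReal.iSup_natCast, ENNReal.iSup_mul]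
    rw [ENNReal.iSup_natCast]
    exact iSup_le fun n => key n le_top

/-! ### Consequences of symmetry -/

variable {E}

/-- Symmetry compares only equimeasurable classes, so the comparison goes from `x` to its
rearrangement, down by the ideal property to the rearrangement of `g`, and back to `g`. Finiteness
of the rearrangement for `t > 0` makes the intermediate functions elements of `L⁰`; `decr_ne_top`
later supplies it for every `x` in the space. -/
theorem funNorm_le_of_decr_lt_top (hE : E.IsSymmetric) {g : ℝ → ℝ≥0∞} (hg : Measurable g)
    (x : E.carrier) (hx : ∀ t, 0 < t → decr α (fun s => ‖(x : L0 α) s‖ₑ) t ≠ ⊤)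
    (h : distr α g ≤ distr α fun s => ‖(x : L0 α) s‖ₑ) : E.funNorm g ≤ ‖x‖ₑ := by
  set f : ℝ → ℝ≥0∞ := fun s => ‖(x : L0 α) s‖ₑ
  have hfin : ∀ {k : ℝ → ℝ≥0∞}, distr α k ≤ distr α f →
      ∀ᵐ s ∂(intervalMeasure α), decr α k s ≠ ⊤ := fun {k} hk => by
    filter_upwards [ae_interval (α := α)] with s hs
    exact ne_top_of_le_ne_top (hx s hs.1) (decr_mono hk s)
  have hmd : ∀ k : ℝ → ℝ≥0∞, Measurable (decr α k) := fun k => (decr_antitone k).measurable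
  have hf := enorm_ofFun (hmd f) (hfin le_rfl)
  have hg1 := enorm_ofFun (hmd g) (hfin h)
  have hgfin : ∀ᵐ s ∂(intervalMeasure α), g s ≠ ⊤ := by
    have h0 : ∀ t : ℝ, 0 < t → ∃ l : ℝ≥0∞, l < ⊤ ∧ distr α g l ≤ ENNReal.ofReal t := fun t ht =>
      ⟨_, lt_top_iff_ne_top.2 (hx t ht), (h _).trans ((decr_le_iff f _ t).1 le_rfl)⟩
    rw [ae_iff]
    refine le_antisymm (le_of_forall_gt_imp_ge_of_dense fun ε hε => ?_) zero_le
    obtain ⟨t, ht, htε⟩ : ∃ t : ℝ, 0 < t ∧ ENNReal.ofReal t ≤ ε := by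
      obtain ⟨r, hr0, hr⟩ := ENNReal.lt_iff_exists_nnreal_btwn.1 hε
      exact ⟨r, by simpa using hr0, by simpa using hr.le⟩
    obtain ⟨l, hl, hlt⟩ := h0 t ht
    refine (measure_mono fun s hs => ?_).trans (hlt.trans htε)
    simp only [ne_eq, not_not, mem_ofPred_eq] at hs
    simpa [hs] using hl
  have hg2 := enorm_ofFun hg hgfin
  obtain ⟨m1, e1⟩ := hE (ofFun α _ (hmd f)) x (by
    rw [Equimeasurable, distribution_eq_distr, distribution_eq_distr, distr_congr hf, distr_decr])
  have hle : (fun s => ‖ofFun α _ (hmd g) s‖ₑ) ≤ᵐ[intervalMeasure α]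
      fun s => ‖ofFun α _ (hmd f) s‖ₑ := by
    filter_upwards [hf, hg1] with s h1 h2
    rw [h1, h2]
    exact decr_mono h s
  have m2 := E.mem_of_ae_le (y := ⟨_, m1⟩) hle
  obtain ⟨m3, e3⟩ := hE (ofFun α g hg) ⟨_, m2⟩ (by
    rw [Equimeasurable, distribution_eq_distr, distribution_eq_distr, distr_congr hg1, distr_decr,
      distr_congr hg2])
  calc E.funNorm g ≤ ‖(⟨_, m3⟩ : E.carrier)‖ₑ := E.funNorm_le _ hg2.symm.le
    _ = ‖(⟨_, m2⟩ : E.carrier)‖ₑ := by rw [← ofReal_norm, e3, ofReal_norm]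
    _ ≤ ‖(⟨_, m1⟩ : E.carrier)‖ₑ := E.enorm_le_of_ae_le hle
    _ = ‖x‖ₑ := by rw [← ofReal_norm, e1, ofReal_norm]

theorem distr_indicator_one (A : Set ℝ) (l : ℝ≥0∞) :
    distr α (A.indicator 1) l = if l < 1 then intervalMeasure α A else 0 := by
  rw [distr]
  split_ifs with h
  · congr 1
    ext s
    by_cases hs : s ∈ A <;> simp [hs, h]
  · have : {s | l < A.indicator (1 : ℝ → ℝ≥0∞) s} = ∅ := by
      ext s
      by_cases hs : s ∈ A <;> simp [hs, not_lt.1 h]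
    rw [this, measure_empty]

theorem funNorm_indicator_le (hE : E.IsSymmetric) {A B : Set ℝ} (hA : MeasurableSet A)
    (hB : MeasurableSet B) (h : intervalMeasure α A ≤ intervalMeasure α B) :
    E.funNorm (A.indicator 1) ≤ E.funNorm (B.indicator 1) := by
  by_cases hB' : E.funNorm (B.indicator 1) = ⊤
  · simp [hB']
  have hBm : Measurable (B.indicator (1 : ℝ → ℝ≥0∞)) := measurable_one.indicator hB
  have e := enorm_ofFun (α := α) hBm (E.ae_ne_top_of_funNorm_lt_top (lt_top_iff_ne_top.2 hB'))
  have hm : ofFun α _ hBm ∈ E.carrier := E.mem_of_funNorm_lt_top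
    ((E.funNorm_mono e.le).trans_lt (lt_top_iff_ne_top.2 hB'))
  have := funNorm_le_of_decr_lt_top hE (g := A.indicator 1) (measurable_one.indicator hA)
    ⟨_, hm⟩ (fun t _ => ?_) ?_
  · refine this.trans ?_
    rw [← E.funNorm_coe]
    exact E.funNorm_mono e.le
  · refine ne_top_of_le_ne_top ENNReal.one_ne_top ((decr_le_iff _ 1 t).2 ?_)
    change distr α (fun s => ‖ofFun α _ hBm s‖ₑ) 1 ≤ _
    rw [distr_congr e, distr_indicator_one]
    simp
  · change _ ≤ distr α (fun s => ‖ofFun α _ hBm s‖ₑ)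
    rw [distr_congr e]
    intro l
    rw [distr_indicator_one, distr_indicator_one]
    split_ifs
    · exact h
    · exact le_rfl

theorem funNorm_indicator_eq_zero {A : Set ℝ} (hA : MeasurableSet A)
    (h : E.funNorm (A.indicator 1) = 0) : intervalMeasure α A = 0 := by
  have hAm : Measurable (A.indicator (1 : ℝ → ℝ≥0∞)) := measurable_one.indicator hA
  have hlt : E.funNorm (A.indicator 1) < ⊤ := h ▸ ENNReal.zero_lt_top
  have e := enorm_ofFun (α := α) hAm (E.ae_ne_top_of_funNorm_lt_top hlt)
  have hm : ofFun α _ hAm ∈ E.carrier := E.mem_of_funNorm_lt_top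
    ((E.funNorm_mono e.le).trans_lt hlt)
  have h0 : ‖(⟨_, hm⟩ : E.carrier)‖ₑ = 0 := by
    rw [← E.funNorm_coe]
    exact le_antisymm ((E.funNorm_mono e.le).trans_eq h) zero_le
  rw [enorm_eq_zero] at h0
  have h1 : ofFun α _ hAm = 0 := congrArg Subtype.val h0
  have h2 := e.symm.trans (by rw [h1])
  rw [measure_eq_zero_iff_ae_notMem]
  filter_upwards [h2, AEEqFun.coeFn_zero (μ := intervalMeasure α) (β := ℝ)] with s hs hs0 hsA
  simp [hsA, hs0] at hs

/-- If the rearrangement were infinite at `t`, each set where `|x| > n` would have measure exceeding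
`t`. Then `n ‖χ_(0,t)‖ ≤ ‖x‖` for all `n`, forcing `χ_(0,t)` to vanish a.e. -/
theorem decr_ne_top (hE : E.IsSymmetric) (x : E.carrier) {t : ℝ} (ht : 0 < t) :
    decr α (fun s => ‖(x : L0 α) s‖ₑ) t ≠ ⊤ := by
  intro htop
  set f : ℝ → ℝ≥0∞ := fun s => ‖(x : L0 α) s‖ₑ
  have hd : ∀ l : ℝ≥0∞, l < ⊤ → ENNReal.ofReal t < distr α f l := fun l hl =>
    (lt_decr_iff f l t).1 (htop ▸ hl)
  have hn : ∀ n : ℕ, n * E.funNorm ((Ioo 0 t).indicator 1) ≤ ‖x‖ₑ := by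
    intro n
    have hB : MeasurableSet {s | (n : ℝ≥0∞) < f s} :=
      measurableSet_lt measurable_const (measurable_enorm_coe _)
    calc (n : ℝ≥0∞) * E.funNorm ((Ioo 0 t).indicator 1)
        ≤ n * E.funNorm ({s | (n : ℝ≥0∞) < f s}.indicator 1) := by
          gcongr
          refine funNorm_indicator_le hE measurableSet_Ioo hB ?_
          refine le_trans ?_ (hd n (by simp)).le
          refine (Measure.restrict_apply_le _ _).trans ?_
          simp
      _ ≤ E.funNorm fun s => n * {s | (n : ℝ≥0∞) < f s}.indicator 1 s := E.mul_funNorm_le _ _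
      _ ≤ E.funNorm f := by
          refine E.funNorm_mono (Eventually.of_forall fun s => ?_)
          by_cases hs : (n : ℝ≥0∞) < f s
          · simp [hs, hs.le]
          · simp [hs]
      _ = ‖x‖ₑ := E.funNorm_coe x
  have h0 : E.funNorm ((Ioo 0 t).indicator 1) = 0 := by
    by_contra h0
    have hle : ⊤ * E.funNorm ((Ioo 0 t).indicator 1) ≤ ‖x‖ₑ := by
      rw [← ENNReal.iSup_natCast, ENNReal.iSup_mul]
      exact iSup_le hn
    rw [ENNReal.top_mul h0, top_le_iff] at hle
    exact enorm_ne_top hle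
  have h1 := funNorm_indicator_eq_zero measurableSet_Ioo h0
  have hα : ENNReal.ofReal t < α := (hd 0 (by simp)).trans_le (distr_le _ _)
  rw [intervalMeasure, Measure.restrict_apply measurableSet_Ioo] at h1
  have h2 : Ioo 0 t ⊆ Ioo 0 t ∩ {s : ℝ | 0 ≤ s ∧ ENNReal.ofReal s < α} := fun s hs =>
    ⟨hs, hs.1.le, (ENNReal.ofReal_le_ofReal hs.2.le).trans_lt hα⟩
  have h3 := (measure_mono h2).trans h1.le
  simp [ht.not_ge] at h3

theorem funNorm_le_of_distr_le (hE : E.IsSymmetric) {f g : ℝ → ℝ≥0∞} (hg : Measurable g)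
    (h : distr α g ≤ distr α f) : E.funNorm g ≤ E.funNorm f :=
  le_iInf₂ fun x hx => funNorm_le_of_decr_lt_top hE hg x (fun _ ht => decr_ne_top hE x ht)
    (h.trans (distr_mono hx))

theorem funNorm_decr (hE : E.IsSymmetric) {f : ℝ → ℝ≥0∞} (hf : Measurable f) :
    E.funNorm (decr α f) = E.funNorm f :=
  le_antisymm (funNorm_le_of_distr_le hE (decr_antitone f).measurable (distr_decr f).le)
    (funNorm_le_of_distr_le hE hf (distr_decr f).ge)

theorem funNorm_rearrangement (hE : E.IsSymmetric) (x : E.carrier) :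
    E.funNorm (rearrangement (x : L0 α)) = ‖x‖ₑ := by
  rw [rearrangement_eq_decr, funNorm_decr hE (measurable_enorm_coe _), funNorm_coe]

theorem funNorm_shift_le (hE : E.IsSymmetric) {f : ℝ → ℝ≥0∞} (hf : Measurable f) {h : ℝ}
    (hh : 0 ≤ h) : E.funNorm ((Ici h).indicator fun s => f (s - h)) ≤ E.funNorm f :=
  funNorm_le_of_distr_le hE ((hf.comp (measurable_id.sub_const h)).indicator measurableSet_Ici)
    (distr_shift_le hf hh)

/-! ### The fundamental function -/

theorem fundamental_eq (t : ℝ) : E.fundamental t = E.funNorm ((Ioo 0 t).indicator 1) := by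
  rw [fundamental, ← funNorm_enorm]
  have : (fun s => ‖chi α t s‖ₑ) =ᵐ[intervalMeasure α] (Ioo 0 t).indicator 1 := by
    filter_upwards [AEEqFun.coeFn_mk (μ := intervalMeasure α) ((Ioo 0 t).indicator fun _ => (1 : ℝ))
      (measurable_const.indicator measurableSet_Ioo).aestronglyMeasurable] with s hs
    rw [chi, hs]
    by_cases h : s ∈ Ioo 0 t <;> simp [h]
  exact le_antisymm (E.funNorm_mono this.le) (E.funNorm_mono this.symm.le)

theorem fundamental_mono : Monotone E.fundamental := fun a b hab => by
  rw [fundamental_eq, fundamental_eq]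
  exact E.funNorm_mono (Eventually.of_forall
    (indicator_le_indicator_of_subset (Ioo_subset_Ioo_right hab) fun _ => zero_le))

theorem fundamental_ne_zero (hα : α ≠ 0) {t : ℝ} (ht : 0 < t) : E.fundamental t ≠ 0 := by
  intro h0
  rw [fundamental_eq] at h0
  have h1 := funNorm_indicator_eq_zero measurableSet_Ioo h0
  obtain ⟨r, hr0, hr⟩ := ENNReal.lt_iff_exists_nnreal_btwn.1 (pos_iff_ne_zero.2 hα)
  have hr0 : (0 : ℝ) < r := by simpa using hr0
  rw [intervalMeasure, Measure.restrict_apply measurableSet_Ioo] at h1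
  have h2 : Ioo 0 (min t r) ⊆ Ioo 0 t ∩ {s : ℝ | 0 ≤ s ∧ ENNReal.ofReal s < α} := fun s hs =>
    ⟨⟨hs.1, hs.2.trans_le (min_le_left _ _)⟩, hs.1.le, lt_of_le_of_lt
      (ENNReal.ofReal_le_ofReal (hs.2.le.trans (min_le_right _ _))) (by simpa using hr)⟩
  have h3 := (measure_mono h2).trans h1.le
  rw [Real.volume_Ioo, sub_zero, nonpos_iff_eq_zero, ENNReal.ofReal_eq_zero] at h3
  exact absurd (lt_min ht hr0) h3.not_gt

/-- A strictly positive element is bounded below on some set of positive measure, whose indicator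
therefore has finite norm. Symmetry transfers this to all intervals of a fixed short length, and
finitely many of them cover `(0,t)`. -/
theorem fundamental_ne_top (hE : E.IsSymmetric) (hα : α ≠ 0) (t : ℝ) : E.fundamental t ≠ ⊤ := by
  obtain ⟨w, hw⟩ := E.exists_pos
  obtain ⟨n, hn⟩ : ∃ n : ℕ, intervalMeasure α {s | 1 < (n : ℝ≥0∞) * ‖(w : L0 α) s‖ₑ} ≠ 0 := by
    by_contra! hcon
    have h0 := measure_iUnion_null hcon
    have h1 : intervalMeasure α univ = 0 := by
      refine measure_mono_null_ae ?_ h0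
      filter_upwards [hw] with s hs _
      have hs' : ‖(w : L0 α) s‖ₑ ≠ 0 := by simpa using hs.ne'
      obtain ⟨n, hn⟩ := ENNReal.exists_nat_mul_gt hs' ENNReal.one_ne_top
      exact mem_iUnion.2 ⟨n, hn⟩
    rw [intervalMeasure_univ] at h1
    exact hα h1
  set A := {s | 1 < (n : ℝ≥0∞) * ‖(w : L0 α) s‖ₑ}
  have hAm : MeasurableSet A :=
    measurableSet_lt measurable_const ((measurable_enorm_coe _).const_mul _)
  have hA : E.funNorm (A.indicator 1) < ⊤ := by
    refine lt_of_le_of_lt ((E.funNorm_mono (g := fun s => (n : NNReal) * ‖(w : L0 α) s‖ₑ)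
      (Eventually.of_forall fun s => ?_)).trans (E.funNorm_mul_le _ _)) ?_
    · by_cases hs : s ∈ A
      · simpa [hs] using le_of_lt hs
      · simp [hs]
    · rw [funNorm_coe]
      exact ENNReal.mul_lt_top ENNReal.coe_lt_top enorm_lt_top
  obtain ⟨r, hr0, hr⟩ := ENNReal.lt_iff_exists_nnreal_btwn.1 (pos_iff_ne_zero.2 hn)
  have hr0 : (0 : ℝ) < r := by simpa using hr0
  have hI : ∀ a : ℝ, E.funNorm ((Ico a (a + r)).indicator 1) < ⊤ := fun a =>
    (funNorm_indicator_le hE measurableSet_Ico hAm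
      ((Measure.restrict_apply_le _ _).trans (by simpa using hr.le))).trans_lt hA
  have hK : ∀ k : ℕ, E.funNorm ((Ico 0 (k * r : ℝ)).indicator 1) < ⊤ := by
    intro k
    induction k with
    | zero =>
      have : (Ico 0 ((0 : ℕ) * r : ℝ)).indicator (1 : ℝ → ℝ≥0∞) = fun _ => 0 := by
        ext s; simp
      rw [this, funNorm_zero]
      simp
    | succ k ih =>
      refine lt_of_le_of_lt ((E.funNorm_mono (Eventually.of_forall fun s => ?_)).trans
        (E.funNorm_add_le _ _)) (ENNReal.add_lt_top.2 ⟨ih, hI (k * r)⟩)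
      by_cases hs : s ∈ Ico 0 ((k + 1 : ℕ) * r : ℝ)
      · rw [indicator_of_mem hs]
        by_cases hs' : s < k * r
        · rw [indicator_of_mem (show s ∈ Ico 0 (k * r : ℝ) from ⟨hs.1, hs'⟩)]
          exact le_self_add
        · rw [indicator_of_mem (s := Ico (k * r : ℝ) _) ⟨not_lt.1 hs', hs.2.trans_eq
            (by push_cast; ring)⟩]
          exact le_add_self
      · rw [indicator_of_notMem hs]
        exact zero_le
  obtain ⟨k, hk⟩ := exists_nat_gt (t / r)
  rw [div_lt_iff₀ hr0] at hk
  rw [fundamental_eq]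
  refine ((E.funNorm_mono (Eventually.of_forall ?_)).trans_lt (hK k)).ne
  exact indicator_le_indicator_of_subset
    (fun s hs => ⟨hs.1.le, hs.2.trans hk⟩) fun _ => zero_le

end BanachFunctionSpace

/-! ### Step functions on cells of equal length -/

/-- The `i`-th cell of length `h`. -/
def cell (h : ℝ) (i : ℕ) : Set ℝ := Ico (i * h) (i * h + h)

theorem measurableSet_cell (h : ℝ) (i : ℕ) : MeasurableSet (cell h i) := measurableSet_Ico

theorem eq_of_mem_cell {h : ℝ} (hh : 0 < h) {s : ℝ} {i j : ℕ} (hi : s ∈ cell h i)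
    (hj : s ∈ cell h j) : i = j := by
  have key : ∀ {i j : ℕ}, s ∈ cell h i → s ∈ cell h j → i ≤ j := fun {i j} hi hj => by
    have h1 : (i : ℝ) * h < (j + 1) * h := by linarith [hi.1, hj.2]
    have h2 : (i : ℝ) < (j + 1 : ℕ) := by
      push_cast
      exact lt_of_mul_lt_mul_right h1 hh.le
    exact Nat.lt_succ_iff.1 (Nat.cast_lt.1 h2)
  exact le_antisymm (key hi hj) (key hj hi)

theorem exists_mem_cell {h : ℝ} (hh : 0 < h) {m : ℕ} {s : ℝ} (hs0 : 0 ≤ s) (hs : s < m * h) :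
    ∃ i : Fin m, s ∈ cell h i := by
  have h0 : 0 ≤ s / h := by positivity
  have h1 : ⌊s / h⌋₊ < m := (Nat.floor_lt h0).2 ((div_lt_iff₀ hh).2 hs)
  refine ⟨⟨_, h1⟩, (le_div_iff₀ hh).1 (Nat.floor_le h0), ?_⟩
  have := (div_lt_iff₀ hh).1 (Nat.lt_floor_add_one (s / h))
  change s < (⌊s / h⌋₊ : ℝ) * h + h
  linarith

theorem intervalMeasure_cell {h : ℝ} (hh : 0 < h) {m : ℕ} (hm : ENNReal.ofReal (m * h) ≤ α)
    (i : Fin m) : intervalMeasure α (cell h i) = ENNReal.ofReal h := by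
  have hsub : cell h i ⊆ {s : ℝ | 0 ≤ s ∧ ENNReal.ofReal s < α} := fun s hs => by
    have h1 : ((i : ℕ) + 1 : ℝ) ≤ m := by exact_mod_cast i.2
    have h2 : ((i : ℕ) + 1 : ℝ) * h ≤ m * h := by gcongr
    have h0 : (0 : ℝ) ≤ (i : ℕ) * h := by positivity
    refine ⟨h0.trans hs.1, lt_of_lt_of_le ?_ hm⟩
    rw [ENNReal.ofReal_lt_ofReal_iff_of_nonneg (h0.trans hs.1)]
    linarith [hs.2]
  rw [intervalMeasure, Measure.restrict_apply (measurableSet_cell h i), inter_eq_left.2 hsub,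
    cell, Real.volume_Ico]
  congr 1
  ring

/-- The step function with value `a i` on the `i`-th cell of length `h`. -/
def step (h : ℝ) {m : ℕ} (a : Fin m → ℝ≥0∞) (s : ℝ) : ℝ≥0∞ :=
  ∑ i : Fin m, a i * (cell h i).indicator 1 s

theorem measurable_step (h : ℝ) {m : ℕ} (a : Fin m → ℝ≥0∞) : Measurable (step h a) :=
  Finset.measurable_sum _ fun i _ =>
    (measurable_one.indicator (measurableSet_cell h i)).const_mul _

theorem step_apply {h : ℝ} (hh : 0 < h) {m : ℕ} (a : Fin m → ℝ≥0∞) {s : ℝ} {i : Fin m}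
    (hs : s ∈ cell h i) : step h a s = a i := by
  rw [step, Finset.sum_eq_single i]
  · simp [hs]
  · intro j _ hj
    have : s ∉ cell h j := fun hs' => hj (Fin.ext (eq_of_mem_cell hh hs' hs))
    simp [this]
  · simp

theorem step_apply_of_notMem {h : ℝ} {m : ℕ} (a : Fin m → ℝ≥0∞) {s : ℝ}
    (hs : ∀ i : Fin m, s ∉ cell h i) : step h a s = 0 := by
  simp [step, hs]

theorem step_mono (h : ℝ) {m : ℕ} {a b : Fin m → ℝ≥0∞} (hab : a ≤ b) : step h a ≤ step h b :=
  fun _ => Finset.sum_le_sum fun i _ => mul_le_mul_left (hab i) _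

theorem distr_step {h : ℝ} (hh : 0 < h) {m : ℕ} (hm : ENNReal.ofReal (m * h) ≤ α)
    (a : Fin m → ℝ≥0∞) (l : ℝ≥0∞) :
    distr α (step h a) l = ∑ i, if l < a i then ENNReal.ofReal h else 0 := by
  have hU : {s | l < step h a s} = ⋃ i ∈ Finset.univ.filter (fun i => l < a i), cell h i := by
    ext s
    simp only [mem_ofPred_eq, mem_iUnion, Finset.mem_filter, Finset.mem_univ, true_and,
      exists_prop]
    constructor
    · intro hs
      by_cases hi : ∃ i : Fin m, s ∈ cell h i
      · obtain ⟨i, hi⟩ := hi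
        exact ⟨i, by rwa [step_apply hh a hi] at hs, hi⟩
      · push Not at hi
        simp [step_apply_of_notMem a hi] at hs
    · rintro ⟨i, hl, hi⟩
      rwa [step_apply hh a hi]
  rw [distr, hU, measure_biUnion_finset, Finset.sum_filter]
  · exact Finset.sum_congr rfl fun i _ => by rw [intervalMeasure_cell hh hm]
  · intro i _ j _ hij
    refine Set.disjoint_left.2 fun s hi hj => hij (Fin.ext (eq_of_mem_cell hh hi hj))
  · exact fun i _ => measurableSet_cell h i

namespace BanachFunctionSpace

variable {E : BanachFunctionSpace α}

theorem funNorm_step_comp_perm (hE : E.IsSymmetric) {h : ℝ} (hh : 0 < h) {m : ℕ}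
    (hm : ENNReal.ofReal (m * h) ≤ α) (a : Fin m → ℝ≥0∞) (σ : Equiv.Perm (Fin m)) :
    E.funNorm (step h (a ∘ σ)) ≤ E.funNorm (step h a) := by
  refine funNorm_le_of_distr_le hE (measurable_step _ _) fun l => ?_
  rw [distr_step hh hm, distr_step hh hm]
  exact (Equiv.sum_comp σ fun i => if l < a i then ENNReal.ofReal h else 0).le

/-- The `m` cyclic shifts of the coefficients add up to the constant `∑ a i` on `(0, mh)`, and each
shifted step function has norm at most that of the original. -/
theorem sum_mul_fundamental_le (hE : E.IsSymmetric) {h : ℝ} (hh : 0 < h) {m : ℕ}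
    (hm : ENNReal.ofReal (m * h) ≤ α) (a : Fin m → ℝ≥0∞) :
    (∑ i, a i) * E.fundamental (m * h) ≤ m * E.funNorm (step h a) := by
  rcases Nat.eq_zero_or_pos m with rfl | hm0
  · simp
  have : NeZero m := ⟨hm0.ne'⟩
  calc (∑ i, a i) * E.fundamental (m * h)
      ≤ E.funNorm (fun s => (∑ i, a i) * (Ioo 0 (m * h)).indicator 1 s) := by
        rw [fundamental_eq]
        exact E.mul_funNorm_le _ _
    _ ≤ E.funNorm (fun s => ∑ j : Fin m, step h (a ∘ Equiv.addLeft j) s) := by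
        refine E.funNorm_mono (Eventually.of_forall fun s => ?_)
        by_cases hs : s ∈ Ioo 0 (m * h)
        · obtain ⟨i, hi⟩ := exists_mem_cell hh hs.1.le hs.2
          simp only [step_apply hh _ hi, Function.comp_apply, Equiv.coe_addLeft,
            indicator_of_mem hs, Pi.one_apply, mul_one]
          exact (Equiv.sum_comp (Equiv.addRight i) a).ge
        · simp [indicator_of_notMem hs]
    _ ≤ ∑ j : Fin m, E.funNorm (step h (a ∘ Equiv.addLeft j)) := E.funNorm_sum_le _ _
    _ ≤ ∑ j : Fin m, E.funNorm (step h a) :=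
        Finset.sum_le_sum fun j _ => funNorm_step_comp_perm hE hh hm a _
    _ = m * E.funNorm (step h a) := by simp

end BanachFunctionSpace

/-! ### Cell integrals and averages of decreasing functions -/

theorem lintegral_Ico_eq_sum_cell (f : ℝ → ℝ≥0∞) {h : ℝ} (hh : 0 ≤ h) (n m : ℕ) :
    ∫⁻ s in Ico (n * h) ((n + m : ℕ) * h), f s
      = ∑ i ∈ Finset.range m, ∫⁻ s in cell h (n + i), f s := by
  induction m with
  | zero => simp
  | succ m ih =>
    rw [Finset.sum_range_succ, ← ih, ← lintegral_union (measurableSet_cell h _)]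
    · congr 2
      rw [cell, Ico_union_Ico_eq_Ico (by gcongr; simp) (by linarith)]
      congr 1
      push_cast
      ring
    · refine Set.disjoint_left.2 fun s h1 h2 => ?_
      exact absurd h1.2 (not_lt.2 h2.1)

theorem lintegral_cell_le {f : ℝ → ℝ≥0∞} (hf : Antitone f) (h : ℝ) (i : ℕ) :
    ∫⁻ s in cell h i, f s ≤ ENNReal.ofReal h * f (i * h) := by
  calc ∫⁻ s in cell h i, f s ≤ ∫⁻ _ in cell h i, f (i * h) :=
        setLIntegral_mono measurable_const fun s hs => hf hs.1
    _ = _ := by simp [cell, mul_comm]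

theorem le_lintegral_cell {f : ℝ → ℝ≥0∞} (hf : Antitone f) (h : ℝ) (i : ℕ) :
    ENNReal.ofReal h * f ((i + 1 : ℕ) * h) ≤ ∫⁻ s in cell h i, f s := by
  calc ENNReal.ofReal h * f ((i + 1 : ℕ) * h) = ∫⁻ _ in cell h i, f ((i + 1 : ℕ) * h) := by
        simp [cell, mul_comm]
    _ ≤ _ := setLIntegral_mono hf.measurable fun s hs => hf (by push_cast; linarith [hs.2])

namespace BanachFunctionSpace

variable {E : BanachFunctionSpace α}

theorem fundamental_mul_lintegral_le_aux (hE : E.IsSymmetric) {f : ℝ → ℝ≥0∞} (hf : Antitone f)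
    {t : ℝ} (ht : 0 < t) (htα : ENNReal.ofReal t ≤ α) (m : ℕ) :
    E.fundamental t * ∫⁻ s in Ico (t / (m + 1 : ℕ)) t, f s
      ≤ ENNReal.ofReal t * E.funNorm f := by
  set h : ℝ := t / (m + 1 : ℕ) with hdef
  have hh : 0 < h := by positivity
  have hmh : ((m + 1 : ℕ) : ℝ) * h = t := by
    rw [hdef]
    field_simp
  -- Sampling `f` at the right end of a cell bounds its integral over the next cell, so the first
  -- cell is lost here. The last sample is surplus, but keeps the sum running over all `m + 1`
  -- cells, where the sampled step function lies below `f`.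
  have hI : ∫⁻ s in Ico h t, f s
      ≤ ENNReal.ofReal h * ∑ i : Fin (m + 1), f (((i : ℕ) + 1 : ℕ) * h) := by
    have h1 : ∫⁻ s in Ico h t, f s = ∑ i ∈ Finset.range m, ∫⁻ s in cell h (i + 1), f s := by
      have := lintegral_Ico_eq_sum_cell f hh.le 1 m
      rw [add_comm 1 m, hmh, Nat.cast_one, one_mul] at this
      simpa only [add_comm 1] using this
    rw [h1, Finset.mul_sum,
      Fin.sum_univ_eq_sum_range (fun i => ENNReal.ofReal h * f ((i + 1 : ℕ) * h)),
      Finset.sum_range_succ]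
    exact (Finset.sum_le_sum fun i _ => lintegral_cell_le hf h (i + 1)).trans le_self_add
  have hm : ENNReal.ofReal ((m + 1 : ℕ) * h) ≤ α := by rwa [hmh]
  calc E.fundamental t * ∫⁻ s in Ico h t, f s
      ≤ E.fundamental t * (ENNReal.ofReal h * ∑ i : Fin (m + 1), f (((i : ℕ) + 1 : ℕ) * h)) := by
        gcongr
    _ = ENNReal.ofReal h * ((∑ i : Fin (m + 1), f (((i : ℕ) + 1 : ℕ) * h))
          * E.fundamental ((m + 1 : ℕ) * h)) := by
        rw [hmh]
        ring
    _ ≤ ENNReal.ofReal h * ((m + 1 : ℕ) *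
          E.funNorm (step h fun i : Fin (m + 1) => f (((i : ℕ) + 1 : ℕ) * h))) := by
        exact mul_le_mul_right (sum_mul_fundamental_le hE hh hm _) _
    _ ≤ ENNReal.ofReal h * ((m + 1 : ℕ) * E.funNorm f) := by
        gcongr
        refine E.funNorm_mono (Eventually.of_forall fun s => ?_)
        by_cases hi : ∃ i : Fin (m + 1), s ∈ cell h i
        · obtain ⟨i, hi⟩ := hi
          rw [step_apply hh _ hi]
          exact hf (by push_cast; linarith [hi.2])
        · push Not at hi
          rw [step_apply_of_notMem _ hi]
          exact zero_le
    _ = ENNReal.ofReal t * E.funNorm f := by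
        rw [← mul_assoc, ← hmh, ENNReal.ofReal_mul (by positivity), ENNReal.ofReal_natCast]
        ring

/-- The averages of a decreasing function are controlled by its norm. -/
theorem fundamental_mul_lintegral_le (hE : E.IsSymmetric) {f : ℝ → ℝ≥0∞} (hf : Antitone f)
    {t : ℝ} (ht : 0 < t) (htα : ENNReal.ofReal t ≤ α) :
    E.fundamental t * ∫⁻ s in Ioo 0 t, f s ≤ ENNReal.ofReal t * E.funNorm f := by
  have hU : Ioo 0 t = ⋃ m : ℕ, Ico (t / (m + 1 : ℕ)) t := by
    ext s
    simp only [mem_Ioo, mem_iUnion, mem_Ico]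
    constructor
    · rintro ⟨h0, h1⟩
      obtain ⟨m, hm⟩ := exists_nat_gt (t / s)
      refine ⟨m, ?_, h1⟩
      rw [div_lt_iff₀ h0] at hm
      rw [div_le_iff₀ (by positivity)]
      push_cast
      nlinarith
    · rintro ⟨m, h0, h1⟩
      exact ⟨lt_of_lt_of_le (by positivity) h0, h1⟩
  have hdir : Directed (· ⊆ ·) fun m : ℕ => Ico (t / (m + 1 : ℕ)) t := by
    refine directed_of_isDirected_le fun i j hij => Ico_subset_Ico_left ?_
    gcongr
  rw [hU, setLIntegral_iUnion_of_directed _ hdir, ENNReal.mul_iSup]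
  exact iSup_le fun m => fundamental_mul_lintegral_le_aux hE hf ht htα m

end BanachFunctionSpace

/-! ### Weak majorization and the norm -/

/-- Abel's inequality for sequences with nonnegative partial sums. -/
theorem sum_mul_nonneg_of_partial_sums {d e : ℕ → ℝ} (hd : Antitone d) (hd0 : ∀ i, 0 ≤ d i) (m : ℕ)
    (he : ∀ k ≤ m, 0 ≤ ∑ i ∈ Finset.range k, e i) : 0 ≤ ∑ i ∈ Finset.range m, d i * e i := by
  have key : ∀ k ≤ m, d k * ∑ i ∈ Finset.range k, e i ≤ ∑ i ∈ Finset.range k, d i * e i := by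
    intro k
    induction k with
    | zero => simp
    | succ k ih =>
      intro hk
      calc d (k + 1) * ∑ i ∈ Finset.range (k + 1), e i
          ≤ d k * ∑ i ∈ Finset.range (k + 1), e i :=
            mul_le_mul_of_nonneg_right (hd k.le_succ) (he _ hk)
        _ = d k * ∑ i ∈ Finset.range k, e i + d k * e k := by
            rw [Finset.sum_range_succ, mul_add]
        _ ≤ _ := by
            rw [Finset.sum_range_succ]
            linarith [ih (by omega)]
  exact (mul_nonneg (hd0 m) (he m le_rfl)).trans (key m le_rfl)

/-- Sorting `c` decreasingly can only increase its pairing with the decreasing `b`. Passing to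
positive parts makes the sorted weights nonnegative and decreasing, so Abel's inequality replaces
`b` by `a`; undoing the sorting puts the permutation on `a`. -/
theorem exists_perm_sum_mul_le {m : ℕ} (c : Fin m → ℝ) {a b : ℕ → ℝ} (hb : Antitone b)
    (hb0 : ∀ i, 0 ≤ b i)
    (hab : ∀ k ≤ m, ∑ i ∈ Finset.range k, b i ≤ ∑ i ∈ Finset.range k, a i) :
    ∃ σ : Equiv.Perm (Fin m), ∑ i : Fin m, c i * b i ≤ ∑ i, max (c i) 0 * a (σ i) := by
  let τ : Equiv.Perm (Fin m) := Tuple.sort fun i => -c i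
  have hτ : Antitone (c ∘ τ) := fun i j hij => by
    have := Tuple.monotone_sort (fun i => -c i) hij
    simpa using this
  refine ⟨τ⁻¹, ?_⟩
  have hmono : Monovary (c ∘ τ) fun i : Fin m => b i :=
    Antitone.monovary hτ fun i j hij => hb hij
  calc ∑ i : Fin m, c i * b i = ∑ i : Fin m, (c ∘ τ) (τ⁻¹ i) * b i := by simp
    _ ≤ ∑ i : Fin m, (c ∘ τ) i * b i := hmono.sum_comp_perm_mul_le_sum_mul
    _ ≤ ∑ i : Fin m, max (c (τ i)) 0 * b i :=
        Finset.sum_le_sum fun i _ => mul_le_mul_of_nonneg_right (le_max_left _ _) (hb0 i)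
    _ ≤ ∑ i : Fin m, max (c (τ i)) 0 * a i := by
        let d : ℕ → ℝ := fun i => if hi : i < m then max (c (τ ⟨i, hi⟩)) 0 else 0
        have hd0 : ∀ i, 0 ≤ d i := fun i => by
          by_cases hi : i < m <;> simp [d, hi]
        have hd : Antitone d := fun i j hij => by
          by_cases hj : j < m
          · have hi : i < m := lt_of_le_of_lt hij hj
            simp only [d, hi, hj, dite_true]
            exact max_le_max_right _ (hτ (show (⟨i, hi⟩ : Fin m) ≤ ⟨j, hj⟩ from hij))
          · have : d j = 0 := by simp [d, hj]
            rw [this]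
            exact hd0 i
        have hdi : ∀ i : Fin m, max (c (τ i)) 0 = d i := fun i => by simp [d]
        have h0 := sum_mul_nonneg_of_partial_sums (e := fun i => a i - b i) hd hd0 m
          fun k hk => by
            rw [Finset.sum_sub_distrib]
            exact sub_nonneg.2 (hab k hk)
        simp only [hdi]
        rw [Fin.sum_univ_eq_sum_range (fun i => d i * b i),
          Fin.sum_univ_eq_sum_range (fun i => d i * a i)]
        simp only [mul_sub, Finset.sum_sub_distrib] at h0
        linarith
    _ = ∑ i : Fin m, max (c i) 0 * a (τ⁻¹ i) := by
        rw [← Equiv.sum_comp τ fun i => max (c i) 0 * a (τ⁻¹ i)]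
        simp

namespace BanachFunctionSpace

variable {E : BanachFunctionSpace α}

theorem coeFn_sum_smul {ι : Type*} (S : Finset ι) (c : ι → ℝ) (u : ι → E.carrier) :
    (((∑ i ∈ S, c i • u i : E.carrier) : L0 α) : ℝ → ℝ)
      =ᵐ[intervalMeasure α] fun s => ∑ i ∈ S, c i * (u i : L0 α) s := by
  classical
  induction S using Finset.induction_on with
  | empty =>
    simp only [Finset.sum_empty]
    exact AEEqFun.coeFn_zero
  | insert i S hi ih =>
    simp only [Finset.sum_insert hi]
    filter_upwards [ih, AEEqFun.coeFn_smul (c i) (u i : L0 α),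
      AEEqFun.coeFn_add ((c i • u i : E.carrier) : L0 α)
        ((∑ i ∈ S, c i • u i : E.carrier) : L0 α)] with s h1 h2 h3
    rw [← h1]
    refine h3.trans ?_
    rw [Pi.add_apply]
    congr 1

/-- Norms of step functions respect weak majorization of the coefficients. -/
theorem funNorm_step_le_of_sum_le (hE : E.IsSymmetric) {h : ℝ} (hh : 0 < h) {m : ℕ}
    (hm : ENNReal.ofReal (m * h) ≤ α) {a b : ℕ → NNReal} (hb : Antitone b)
    (hab : ∀ k ≤ m, ∑ i ∈ Finset.range k, b i ≤ ∑ i ∈ Finset.range k, a i) :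
    E.funNorm (step h fun i : Fin m => (b i : ℝ≥0∞))
      ≤ E.funNorm (step h fun i : Fin m => (a i : ℝ≥0∞)) := by
  rcases Nat.eq_zero_or_pos m with rfl | hm0
  · exact E.funNorm_mono (Eventually.of_forall fun s => by simp [step])
  have hα : α ≠ 0 := by
    rintro rfl
    simp only [nonpos_iff_eq_zero, ENNReal.ofReal_eq_zero] at hm
    exact absurd hm (not_le.2 (by positivity))
  have hcm : ∀ i : Fin m, Measurable ((cell h i).indicator (1 : ℝ → ℝ≥0∞)) := fun i =>
    measurable_one.indicator (measurableSet_cell h i)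
  have hcell : ∀ i : Fin m, (fun s => ‖ofFun α _ (hcm i) s‖ₑ)
      =ᵐ[intervalMeasure α] (cell h i).indicator 1 := fun i =>
    enorm_ofFun (hcm i) (Eventually.of_forall fun s => by
      by_cases hs : s ∈ cell h i <;> simp [hs])
  have hmem : ∀ i : Fin m, ofFun α _ (hcm i) ∈ E.carrier := fun i => by
    refine E.mem_of_funNorm_lt_top ((E.funNorm_mono (hcell i).le).trans_lt ?_)
    have : E.funNorm ((cell h i).indicator 1) ≤ E.fundamental (m * h) := by
      have h2 : ((i : ℕ) + 1 : ℝ) * h ≤ m * h := by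
        gcongr
        exact_mod_cast i.2
      rw [fundamental_eq]
      refine E.funNorm_mono ?_
      filter_upwards [ae_interval (α := α)] with s hs0
      refine indicator_le_indicator_apply_of_subset (f := 1)
        (s := cell h i ∩ Ioi 0) (t := Ioo 0 (m * h)) (a := s) ?_ zero_le |>.trans' ?_
      · exact fun s hs => ⟨hs.2, by linarith [hs.1.2]⟩
      · by_cases hs : s ∈ cell h i <;> simp [hs, hs0.1]
    exact this.trans_lt (lt_top_iff_ne_top.2 (fundamental_ne_top hE hα _))
  let u : Fin m → E.carrier := fun i => ⟨_, hmem i⟩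
  have hu : ∀ i, ((u i : L0 α) : ℝ → ℝ) =ᵐ[intervalMeasure α] (cell h i).indicator 1 := fun i => by
    filter_upwards [AEEqFun.coeFn_mk (μ := intervalMeasure α) _
      (hcm i).ennreal_toReal.aestronglyMeasurable] with s hs
    refine hs.trans ?_
    by_cases hs : s ∈ cell h i <;> simp [hs]
  have hnorm : ∀ v : Fin m → NNReal,
      ‖∑ i, (v i : ℝ) • u i‖ₑ = E.funNorm (step h fun i => (v i : ℝ≥0∞)) := fun v => by
    rw [← E.funNorm_coe]
    have : (fun s => ‖((∑ i, (v i : ℝ) • u i : E.carrier) : L0 α) s‖ₑ)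
        =ᵐ[intervalMeasure α] step h fun i => (v i : ℝ≥0∞) := by
      filter_upwards [coeFn_sum_smul Finset.univ (fun i => (v i : ℝ)) u,
        ae_all_iff.2 hu] with s h1 h2
      have h3 : ∑ i, (v i : ℝ) * (u i : L0 α) s
          = ((∑ i, v i * (cell h i).indicator (1 : ℝ → NNReal) s : NNReal) : ℝ) := by
        push_cast
        refine Finset.sum_congr rfl fun i _ => ?_
        rw [h2 i]
        by_cases hs : s ∈ cell h i <;> simp [hs]
      have h4 : step h (fun i => (v i : ℝ≥0∞)) s
          = ((∑ i, v i * (cell h i).indicator (1 : ℝ → NNReal) s : NNReal) : ℝ≥0∞) := by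
        rw [step]
        push_cast
        refine Finset.sum_congr rfl fun i _ => ?_
        by_cases hs : s ∈ cell h i <;> simp [hs]
      rw [h1, h3, h4, Real.enorm_eq_ofReal NNReal.zero_le_coe, ENNReal.ofReal_coe_nnreal]
    exact le_antisymm (E.funNorm_mono this.le) (E.funNorm_mono this.symm.le)
  -- A norming functional for the smaller step function reduces the claim to finite sums, with
  -- weights `p (u i)` on the cells.
  obtain ⟨p, hp1, hp⟩ := exists_dual_vector'' ℝ (∑ i : Fin m, (b i : ℝ) • u i)
  obtain ⟨σ, hσ⟩ := exists_perm_sum_mul_le (fun i => p (u i)) (a := fun i => (a i : ℝ))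
    (b := fun i => (b i : ℝ)) (fun i j hij => NNReal.coe_le_coe.2 (hb hij))
    (fun i => (b i).2) (fun k hk => by exact_mod_cast hab k hk)
  -- Discarding the cells where `p` is not positive realizes the positive parts of the weights, and
  -- keeps `v` below a permutation of `a`.
  let v : Fin m → NNReal := fun i => if 0 < p (u i) then a (σ i) else 0
  have hle : ‖∑ i : Fin m, (b i : ℝ) • u i‖ ≤ ‖∑ i : Fin m, (v i : ℝ) • u i‖ := by
    calc ‖∑ i : Fin m, (b i : ℝ) • u i‖ = p (∑ i : Fin m, (b i : ℝ) • u i) := hp.symm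
      _ = ∑ i : Fin m, p (u i) * (b i : ℝ) := by simp [mul_comm]
      _ ≤ ∑ i : Fin m, max (p (u i)) 0 * (a (σ i) : ℝ) := hσ
      _ = p (∑ i : Fin m, (v i : ℝ) • u i) := by
        simp only [map_sum, map_smul, smul_eq_mul]
        refine Finset.sum_congr rfl fun i _ => ?_
        by_cases hi : 0 < p (u i)
        · simp only [v, hi, if_true, max_eq_left hi.le]
          ring
        · simp [v, hi, max_eq_right (not_lt.1 hi)]
      _ ≤ ‖p (∑ i : Fin m, (v i : ℝ) • u i)‖ := le_abs_self _
      _ ≤ ‖p‖ * ‖∑ i : Fin m, (v i : ℝ) • u i‖ := p.le_opNorm _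
      _ ≤ 1 * ‖∑ i : Fin m, (v i : ℝ) • u i‖ := by gcongr
      _ = _ := one_mul _
  calc E.funNorm (step h fun i : Fin m => (b i : ℝ≥0∞))
      = ‖∑ i : Fin m, (b i : ℝ) • u i‖ₑ := (hnorm fun i => b i).symm
    _ ≤ ‖∑ i : Fin m, (v i : ℝ) • u i‖ₑ := enorm_le_iff_norm_le.2 hle
    _ = E.funNorm (step h fun i => (v i : ℝ≥0∞)) := hnorm v
    _ ≤ E.funNorm (step h ((fun i : Fin m => (a i : ℝ≥0∞)) ∘ σ)) := by
        refine E.funNorm_mono (Eventually.of_forall (step_mono h fun i => ?_))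
        by_cases hi : 0 < p (u i) <;> simp [v, hi]
    _ ≤ _ := funNorm_step_comp_perm hE hh hm _ σ

theorem lintegral_ne_top (hE : E.IsSymmetric) (hα : α ≠ 0) {f : ℝ → ℝ≥0∞} (hf : Antitone f)
    (hfE : E.funNorm f ≠ ⊤) {t : ℝ} (ht : 0 < t) (htα : ENNReal.ofReal t ≤ α) :
    ∫⁻ s in Ioo 0 t, f s ≠ ⊤ := by
  intro h
  have := fundamental_mul_lintegral_le hE hf ht htα
  rw [h, ENNReal.mul_top (fundamental_ne_zero hα ht), top_le_iff] at this
  exact ENNReal.mul_ne_top ENNReal.ofReal_ne_top hfE this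

theorem ofReal_mul_le_lintegral {f : ℝ → ℝ≥0∞} (hf : Antitone f) (t : ℝ) :
    ENNReal.ofReal t * f t ≤ ∫⁻ s in Ioo 0 t, f s := by
  calc ENNReal.ofReal t * f t = ∫⁻ _ in Ioo 0 t, f t := by simp [mul_comm]
    _ ≤ _ := setLIntegral_mono hf.measurable fun s hs => hf hs.2.le

/-- A truncated form of the monotonicity of the norm with respect to the
Hardy-Littlewood-Pólya relation. -/
theorem funNorm_indicator_le_two_mul (hE : E.IsSymmetric) {f g : ℝ → ℝ≥0∞} (hf : Antitone f)
    (hg : Antitone g) (hgf : ∀ t, 0 < t → ∫⁻ s in Ioo 0 t, g s ≤ ∫⁻ s in Ioo 0 t, f s)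
    {δ R : ℝ} (hδ : 0 < δ) (hR : ENNReal.ofReal R ≤ α) :
    E.funNorm ((Ico δ R).indicator g) ≤ 2 * E.funNorm f := by
  rcases le_or_gt R 0 with hR0 | hR0
  · rw [Ico_eq_empty (by linarith), indicator_empty]
    simp [funNorm_zero]
  by_cases hfE : E.funNorm f = ⊤
  · simp [hfE]
  have hα : α ≠ 0 := by
    rintro rfl
    simp only [nonpos_iff_eq_zero, ENNReal.ofReal_eq_zero] at hR
    linarith
  -- This makes the cell length `R / m` at most `δ`, so every point of `[δ, R)` can be moved one
  -- cell to the left.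
  obtain ⟨m, hm⟩ := exists_nat_gt (R / δ)
  have hm0 : (0 : ℝ) < m := lt_trans (by positivity) hm
  set h : ℝ := R / m with hdef
  have hh : 0 < h := by positivity
  have hmh : (m : ℝ) * h = R := by
    rw [hdef]
    field_simp
  have hhδ : h ≤ δ := by
    rw [div_lt_iff₀ hδ] at hm
    rw [hdef, div_le_iff₀ hm0]
    linarith
  have hmα : ENNReal.ofReal (m * h) ≤ α := by rwa [hmh]
  have hhR : h ≤ R := by
    rw [← hmh]
    exact le_mul_of_one_le_left hh.le
      (Nat.one_le_cast.2 (Nat.one_le_iff_ne_zero.2 (Nat.cast_ne_zero.1 hm0.ne')))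
  have hhα : ENNReal.ofReal h ≤ α := (ENNReal.ofReal_le_ofReal hhR).trans hR
  have hh0 : ENNReal.ofReal h ≠ 0 := by simpa using hh
  have hIoo : ∀ k : ℕ, ∀ F : ℝ → ℝ≥0∞, ∑ i ∈ Finset.range k, ∫⁻ s in cell h i, F s
      = ∫⁻ s in Ioo 0 (k * h), F s := fun k F => by
    have := lintegral_Ico_eq_sum_cell F hh.le 0 k
    simp only [zero_add, Nat.cast_zero, zero_mul] at this
    rw [← this, Measure.restrict_congr_set Ioo_ae_eq_Ico]
  have hint : ∀ F : ℝ → ℝ≥0∞, (∀ t, 0 < t → ∫⁻ s in Ioo 0 t, F s ≤ ∫⁻ s in Ioo 0 t, f s) →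
      ∀ i < m, ∫⁻ s in cell h i, F s ≠ ⊤ := fun F hF i hi => by
    have h1 : ∑ i ∈ Finset.range m, ∫⁻ s in cell h i, F s ≠ ⊤ := by
      rw [hIoo, hmh]
      exact ne_top_of_le_ne_top (lintegral_ne_top hE hα hf hfE hR0 hR) (hF R hR0)
    exact ENNReal.sum_ne_top.1 h1 i (Finset.mem_range.2 hi)
  -- Averages over cells in `(0,R)`, extended by zero so that the averages of `g` decrease on all of
  -- `ℕ`. They are finite because `f` is integrable on `(0,R)`.
  let avg : (ℝ → ℝ≥0∞) → ℕ → NNReal := fun F i =>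
    if i < m then ((∫⁻ s in cell h i, F s) / ENNReal.ofReal h).toNNReal else 0
  have havg : ∀ F : ℝ → ℝ≥0∞, (∀ t, 0 < t → ∫⁻ s in Ioo 0 t, F s ≤ ∫⁻ s in Ioo 0 t, f s) →
      ∀ i < m, (avg F i : ℝ≥0∞) = (∫⁻ s in cell h i, F s) / ENNReal.ofReal h :=
    fun F hF i hi => by
      simp only [avg, hi, if_true]
      rw [ENNReal.coe_toNNReal (ENNReal.div_ne_top (hint F hF i hi) hh0)]
  have havg_sum : ∀ F : ℝ → ℝ≥0∞,
      (∀ t, 0 < t → ∫⁻ s in Ioo 0 t, F s ≤ ∫⁻ s in Ioo 0 t, f s) → ∀ k ≤ m,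
      ((∑ i ∈ Finset.range k, avg F i : NNReal) : ℝ≥0∞)
        = (∫⁻ s in Ioo 0 (k * h), F s) / ENNReal.ofReal h := fun F hF k hk => by
    push_cast
    rw [← hIoo, ENNReal.div_eq_inv_mul, Finset.mul_sum]
    refine Finset.sum_congr rfl fun i hi => ?_
    rw [havg F hF i (lt_of_lt_of_le (Finset.mem_range.1 hi) hk), ENNReal.div_eq_inv_mul]
  have havg_le : ∀ F : ℝ → ℝ≥0∞, Antitone F →
      (∀ t, 0 < t → ∫⁻ s in Ioo 0 t, F s ≤ ∫⁻ s in Ioo 0 t, f s) →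
      ∀ i < m, (avg F i : ℝ≥0∞) ≤ F (i * h) := fun F hF hF' i hi => by
    rw [havg F hF' i hi]
    refine ENNReal.div_le_of_le_mul ?_
    rw [mul_comm]
    exact lintegral_cell_le hF h i
  have hle_avg : ∀ F : ℝ → ℝ≥0∞, Antitone F →
      (∀ t, 0 < t → ∫⁻ s in Ioo 0 t, F s ≤ ∫⁻ s in Ioo 0 t, f s) →
      ∀ i < m, F ((i + 1 : ℕ) * h) ≤ avg F i := fun F hF hF' i hi => by
    rw [havg F hF' i hi, ENNReal.le_div_iff_mul_le (Or.inl hh0) (Or.inl ENNReal.ofReal_ne_top),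
      mul_comm]
    exact le_lintegral_cell hF h i
  have havg_anti : Antitone (avg g) := antitone_nat_of_succ_le fun i => by
    by_cases hi : i + 1 < m
    · exact ENNReal.coe_le_coe.1 ((havg_le g hg hgf (i + 1) hi).trans
        (hle_avg g hg hgf i (by omega)))
    · simp [avg, hi]
  have hff : ∀ t, 0 < t → ∫⁻ s in Ioo 0 t, f s ≤ ∫⁻ s in Ioo 0 t, f s := fun _ _ => le_rfl
  have hmaj := funNorm_step_le_of_sum_le hE hh hmα (a := avg f) (b := avg g) havg_anti
    fun k hk => by
      rw [← ENNReal.coe_le_coe, havg_sum g hgf k hk, havg_sum f hff k hk]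
      refine ENNReal.div_le_div_right ?_ _
      rcases Nat.eq_zero_or_pos k with rfl | hk0
      · simp
      · exact hgf _ (by positivity)
  calc E.funNorm ((Ico δ R).indicator g)
      ≤ E.funNorm ((Ici h).indicator fun s =>
          step h (fun i : Fin m => (avg g i : ℝ≥0∞)) (s - h)) := by
        refine E.funNorm_mono (Eventually.of_forall fun s => ?_)
        -- If `s - h` lies in cell `i`, then `s ≥ (i+1)h`, so `g s` is at most the average of `g`
        -- over that cell.
        by_cases hs : s ∈ Ico δ R
        · have hsh : s ∈ Ici h := hhδ.trans hs.1
          rw [indicator_of_mem hs, indicator_of_mem hsh]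
          obtain ⟨i, hi⟩ := exists_mem_cell (m := m) hh (s := s - h) (sub_nonneg.2 hsh)
            (by rw [hmh]; linarith [hs.2])
          rw [step_apply hh _ hi]
          refine le_trans (hg ?_) (hle_avg g hg hgf i i.2)
          push_cast
          linarith [hi.1]
        · rw [indicator_of_notMem hs]
          exact zero_le
    _ ≤ E.funNorm (step h fun i : Fin m => (avg g i : ℝ≥0∞)) :=
        funNorm_shift_le hE (measurable_step _ _) hh.le
    _ ≤ E.funNorm (step h fun i : Fin m => (avg f i : ℝ≥0∞)) := hmaj
    _ ≤ E.funNorm (fun s => avg f 0 * (Ioo 0 h).indicator 1 s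
          + (Ici h).indicator (fun s => f (s - h)) s) := by
        refine E.funNorm_mono ?_
        filter_upwards [ae_interval (α := α)] with s hs0
        by_cases hi : ∃ i : Fin m, s ∈ cell h i
        · obtain ⟨i, hi⟩ := hi
          rw [step_apply hh _ hi]
          rcases Nat.eq_zero_or_pos (i : ℕ) with h0 | h0
          · rw [h0] at hi ⊢
            have : s ∈ Ioo 0 h := ⟨hs0.1, by simpa [cell] using hi.2⟩
            rw [indicator_of_mem this]
            simp
          · have h1 : (1 : ℝ) ≤ (i : ℕ) := by exact_mod_cast h0
            have hsh : s ∈ Ici h := le_trans (by nlinarith) hi.1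
            rw [indicator_of_mem hsh]
            refine le_trans ((havg_le f hf hff i i.2).trans (hf ?_)) le_add_self
            linarith [hi.2]
        · push Not at hi
          rw [step_apply_of_notMem _ hi]
          exact zero_le
    _ ≤ avg f 0 * E.fundamental h + E.funNorm f := by
        rw [fundamental_eq]
        exact (E.funNorm_add_le _ _).trans
          (add_le_add (E.funNorm_mul_le _ _) (funNorm_shift_le hE hf.measurable hh.le))
    _ ≤ E.funNorm f + E.funNorm f := by
        -- The contribution of the first cell is `φ(h)` times the average of `f` over `(0,h)`,
        -- bounded by the norm of `f`.
        gcongr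
        have h1 := fundamental_mul_lintegral_le hE hf hh hhα
        have h2 := hIoo 1 f
        rw [Finset.sum_range_one, Nat.cast_one, one_mul] at h2
        rw [havg f hff 0 (by exact_mod_cast hm0), h2, mul_comm, ← mul_div_assoc]
        refine ENNReal.div_le_of_le_mul ?_
        rwa [mul_comm (E.funNorm f)]
    _ = 2 * E.funNorm f := (two_mul _).symm

end BanachFunctionSpace

theorem lintegral_rearrangement_le_of_HLP {x y : L0 α} (h : HLP x y) {t : ℝ} (ht : 0 < t) :
    ∫⁻ s in Ioo 0 t, rearrangement x s ≤ ∫⁻ s in Ioo 0 t, rearrangement y s := by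
  have h0 : ENNReal.ofReal t ≠ 0 := by simpa using ht
  have := mul_le_mul_left (h t ht) (ENNReal.ofReal t)
  rwa [maximal, maximal, ENNReal.div_mul_cancel h0 ENNReal.ofReal_ne_top,
    ENNReal.div_mul_cancel h0 ENNReal.ofReal_ne_top] at this

theorem exists_seq_exhausting (hα : α = 1 ∨ α = ⊤) :
    ∃ R : ℕ → ℝ, (∀ n, ENNReal.ofReal (R n) ≤ α) ∧
      ∀ s : ℝ, ENNReal.ofReal s < α → ∀ᶠ n in atTop, s < R n := by
  rcases hα with rfl | rfl
  · exact ⟨fun _ => 1, by simp, fun s hs => Eventually.of_forall fun _ => by simpa using hs⟩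
  · exact ⟨fun n => n, by simp, fun s _ => tendsto_natCast_atTop_atTop.eventually_gt_atTop s⟩

theorem tendsto_enorm_zero_iff {F : Type*} [SeminormedAddCommGroup F] {u : ℕ → F} :
    Tendsto (fun n => ‖u n‖ₑ) atTop (𝓝 0) ↔ Tendsto (fun n => ‖u n‖) atTop (𝓝 0) := by
  simp only [← ofReal_norm]
  constructor
  · intro h
    have := (ENNReal.tendsto_toReal ENNReal.zero_ne_top).comp h
    refine Tendsto.congr (fun n => ?_) this
    simp
  · intro h
    simpa using ENNReal.tendsto_ofReal h

/-! ### From order continuity to `K`-order continuity -/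

namespace BanachFunctionSpace

variable {E : BanachFunctionSpace α}

/-- Since `f` need not be a class in the space, order continuity is applied to the restrictions to
`A n` of `|z|`, for some `z` in the space dominating `f`. -/
theorem OrderContinuous.tendsto_funNorm_indicator (hOC : E.OrderContinuous) {f : ℝ → ℝ≥0∞}
    (hf : E.funNorm f ≠ ⊤) {A : ℕ → Set ℝ} (hA : ∀ n, MeasurableSet (A n))
    (h : ∀ᵐ s ∂(intervalMeasure α), ∀ᶠ n in atTop, s ∉ A n) :
    Tendsto (fun n => E.funNorm ((A n).indicator f)) atTop (𝓝 0) := by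
  obtain ⟨z, hz, -⟩ := E.exists_of_funNorm_lt (lt_top_iff_ne_top.2 hf)
  have hm : ∀ n, Measurable ((A n).indicator fun s => ‖(z : L0 α) s‖ₑ) := fun n =>
    (measurable_enorm_coe _).indicator (hA n)
  have hcoe : ∀ n, (ofFun α _ (hm n) : ℝ → ℝ) =ᵐ[intervalMeasure α]
      (A n).indicator fun s => |(z : L0 α) s| := fun n => by
    filter_upwards [AEEqFun.coeFn_mk (μ := intervalMeasure α) _
      (hm n).ennreal_toReal.aestronglyMeasurable] with s hs
    refine hs.trans ?_
    by_cases hs : s ∈ A n <;> simp [hs]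
  have hle : ∀ n, |ofFun α _ (hm n)| ≤ |(z : L0 α)| := fun n => by
    rw [enorm_le_enorm_iff]
    filter_upwards [hcoe n] with s hs
    rw [hs]
    by_cases hs : s ∈ A n <;> simp [hs]
  let u : ℕ → E.carrier := fun n => ⟨_, E.mem_of_ae_le (enorm_le_enorm_iff.1 (hle n))⟩
  have hu := hOC z u (fun n => by
      rw [← AEEqFun.coeFn_le]
      filter_upwards [hcoe n, AEEqFun.coeFn_zero (μ := intervalMeasure α) (β := ℝ)] with s h1 h2
      change _ ≤ ofFun α _ (hm n) s
      rw [h1, h2]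
      exact indicator_nonneg (fun _ _ => abs_nonneg _) _)
    (fun n => by
      rw [← AEEqFun.coeFn_le]
      filter_upwards [hcoe n, AEEqFun.coeFn_abs (z : L0 α)] with s h1 h2
      change ofFun α _ (hm n) s ≤ _
      rw [h1, h2]
      exact indicator_le_self' (fun _ _ => abs_nonneg _) _)
    (by
      filter_upwards [ae_all_iff.2 hcoe, h] with s h1 h2
      refine tendsto_const_nhds.congr' ?_
      filter_upwards [h2] with n hn
      change _ = ofFun α _ (hm n) s
      rw [h1 n, indicator_of_notMem hn])
  rw [← tendsto_enorm_zero_iff] at hu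
  refine tendsto_of_tendsto_of_tendsto_of_le_of_le tendsto_const_nhds hu (fun _ => zero_le)
    fun n => E.funNorm_le _ ?_
  filter_upwards [hz, hcoe n] with s h1 h2
  change _ ≤ ‖ofFun α _ (hm n) s‖ₑ
  rw [h2]
  by_cases hs : s ∈ A n
  · simpa [hs] using h1
  · simp [hs]

/-- Order continuous symmetric spaces are fully symmetric up to a constant. -/
theorem OrderContinuous.funNorm_le_two_mul (hα : α = 1 ∨ α = ⊤) (hE : E.IsSymmetric)
    (hOC : E.OrderContinuous) {f g : ℝ → ℝ≥0∞} (hf : Antitone f) (hg : Antitone g)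
    (hgE : E.funNorm g ≠ ⊤)
    (hgf : ∀ t, 0 < t → ∫⁻ s in Ioo 0 t, g s ≤ ∫⁻ s in Ioo 0 t, f s) :
    E.funNorm g ≤ 2 * E.funNorm f := by
  obtain ⟨R, hR, hRs⟩ := exists_seq_exhausting hα
  let δ : ℕ → ℝ := fun n => 1 / (n + 1 : ℝ)
  have hδ : ∀ n, 0 < δ n := fun n => by positivity
  -- The removed ends shrink to a null set, which replaces a Fatou-type limit by order continuity
  -- applied to `g`.
  have hlim := hOC.tendsto_funNorm_indicator hgE (A := fun n => Iio (δ n) ∪ Ici (R n))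
    (fun n => measurableSet_Iio.union measurableSet_Ici) (by
      filter_upwards [ae_interval (α := α)] with s hs
      filter_upwards [hRs s hs.2, tendsto_one_div_add_atTop_nhds_zero_nat.eventually_lt_const hs.1]
        with n h1 h2
      simp only [mem_union, mem_Iio, mem_Ici, not_or, not_lt, not_le]
      exact ⟨h2.le, h1⟩)
  have hlim' := hlim.const_add (2 * E.funNorm f)
  rw [add_zero] at hlim'
  refine ge_of_tendsto' hlim' fun n => ?_
  calc E.funNorm g ≤ E.funNorm (fun s => (Ico (δ n) (R n)).indicator g s
        + (Iio (δ n) ∪ Ici (R n)).indicator g s) := by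
        refine E.funNorm_mono (Eventually.of_forall fun s => ?_)
        beta_reduce
        by_cases hs : s ∈ Ico (δ n) (R n)
        · rw [indicator_of_mem hs]
          exact le_self_add
        · have : s ∈ Iio (δ n) ∪ Ici (R n) := by
            by_contra hcon
            simp only [mem_union, mem_Iio, mem_Ici, not_or, not_lt, not_le] at hcon
            exact hs hcon
          rw [indicator_of_mem this]
          exact le_add_self
    _ ≤ E.funNorm ((Ico (δ n) (R n)).indicator g)
        + E.funNorm ((Iio (δ n) ∪ Ici (R n)).indicator g) := E.funNorm_add_le _ _
    _ ≤ _ := by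
        gcongr
        exact funNorm_indicator_le_two_mul hE hf hg hgf (hδ n) (hR n)

/-- The bound must hold with one `b` for all `g ≺ f`. The translate of `g` by `b` is majorized by
the function equal to the average `c` of `f` on `(0,b)` and to `f` beyond; its norm depends only on
`f` and `b`. -/
theorem exists_funNorm_tail_le_of_top {E : BanachFunctionSpace ⊤} (hE : E.IsSymmetric)
    (hOC : E.OrderContinuous) {f : ℝ → ℝ≥0∞} (hf : Antitone f) (hfE : E.funNorm f ≠ ⊤)
    (hlim : Tendsto (fun s => E.fundamental s * ((∫⁻ r in Ioo 0 s, f r) / ENNReal.ofReal s))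
      atTop (𝓝 0)) {ε : ℝ≥0∞} (hε : 0 < ε) :
    ∃ b : ℝ, 0 < b ∧ ∀ g : ℝ → ℝ≥0∞, Antitone g → E.funNorm g ≠ ⊤ →
      (∀ t, 0 < t → ∫⁻ s in Ioo 0 t, g s ≤ ∫⁻ s in Ioo 0 t, f s) →
      E.funNorm ((Ici b).indicator g) ≤ ε := by
  have hε4 : 0 < ε / 4 := ENNReal.div_pos hε.ne' (by simp)
  have htail := hOC.tendsto_funNorm_indicator hfE (A := fun n : ℕ => Ici (n : ℝ))
    (fun n => measurableSet_Ici) (Eventually.of_forall fun s => by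
      filter_upwards [tendsto_natCast_atTop_atTop.eventually_gt_atTop s] with n hn
      simpa using hn)
  obtain ⟨n, h1, h2, hn0⟩ := ((ENNReal.tendsto_nhds_zero.1 htail _ hε4).and
    ((ENNReal.tendsto_nhds_zero.1 (hlim.comp tendsto_natCast_atTop_atTop) _ hε4).and
      (eventually_gt_atTop 0))).exists
  set b : ℝ := (n : ℝ)
  have hb : 0 < b := by simpa [b] using hn0
  have hb0 : ENNReal.ofReal b ≠ 0 := by simpa using hb
  refine ⟨b, hb, fun g hg hgE hgf => ?_⟩
  have hfin := lintegral_ne_top hE (by simp) hf hfE hb le_top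
  set c : ℝ≥0∞ := (∫⁻ r in Ioo 0 b, f r) / ENNReal.ofReal b with hc
  have hctop : c ≠ ⊤ := ENNReal.div_ne_top hfin hb0
  have hcb : c * ENNReal.ofReal b = ∫⁻ r in Ioo 0 b, f r :=
    ENNReal.div_mul_cancel hb0 ENNReal.ofReal_ne_top
  have hle_c : ∀ k : ℝ → ℝ≥0∞, Antitone k →
      (∫⁻ s in Ioo 0 b, k s ≤ ∫⁻ s in Ioo 0 b, f s) → k b ≤ c := fun k hk hkf => by
    rw [hc, ENNReal.le_div_iff_mul_le (Or.inl hb0) (Or.inl ENNReal.ofReal_ne_top), mul_comm]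
    exact (ofReal_mul_le_lintegral hk b).trans hkf
  let y : ℝ → ℝ≥0∞ := fun s => if s < b then c else f s
  have hy : Antitone y := fun s t hst => by
    simp only [y]
    split_ifs with h3 h4 h4
    · exact le_rfl
    · exact absurd (hst.trans_lt h3) h4
    · exact (hf (not_lt.1 h3)).trans (hle_c f hf le_rfl)
    · exact hf hst
  have hg' : Antitone fun s => g (s + b) := fun s t hst => hg (by linarith)
  have hg'le : E.funNorm (fun s => g (s + b)) ≤ E.funNorm g :=
    E.funNorm_mono (Eventually.of_forall fun s => hg (by linarith))
  have hyb : ∀ t ≤ b, ∫⁻ s in Ioo 0 t, y s = c * ENNReal.ofReal t := fun t ht => by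
    rw [setLIntegral_congr_fun (g := fun _ => c) measurableSet_Ioo fun s hs => ?_]
    · simp
    · simp [y, hs.2.trans_le ht]
  -- Up to `b`, the translate is bounded by `g b ≤ c`. Beyond `b`, the function `y` has the same
  -- integral from the origin as `f`, which dominates that of `g` and of its translate.
  have hmaj : ∀ t, 0 < t → ∫⁻ s in Ioo 0 t, g (s + b) ≤ ∫⁻ s in Ioo 0 t, y s := by
    intro t ht
    rcases le_or_gt t b with htb | htb
    · rw [hyb t htb]
      calc ∫⁻ s in Ioo 0 t, g (s + b) ≤ ∫⁻ _ in Ioo 0 t, c :=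
            setLIntegral_mono measurable_const fun s hs =>
              (hg (by linarith [hs.1])).trans (hle_c g hg (hgf b hb))
        _ = _ := by simp
    · have hsplit : ∀ F : ℝ → ℝ≥0∞, ∫⁻ s in Ioo 0 t, F s
          = (∫⁻ s in Ioo 0 b, F s) + ∫⁻ s in Ico b t, F s := fun F => by
        rw [← Ioo_union_Ico_eq_Ioo hb htb.le, lintegral_union measurableSet_Ico]
        exact Set.disjoint_left.2 fun s h1 h2 => absurd h1.2 (not_lt.2 h2.1)
      calc ∫⁻ s in Ioo 0 t, g (s + b) ≤ ∫⁻ s in Ioo 0 t, g s :=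
            lintegral_mono fun s => hg (by linarith)
        _ ≤ ∫⁻ s in Ioo 0 t, f s := hgf t ht
        _ = ∫⁻ s in Ioo 0 t, y s := by
            rw [hsplit, hsplit, hyb b le_rfl, hcb]
            congr 1
            refine setLIntegral_congr_fun measurableSet_Ico fun s hs => ?_
            simp [y, hs.1]
  have hyE : E.funNorm y ≤ ε / 4 + ε / 4 := by
    calc E.funNorm y ≤ E.funNorm (fun s => c.toNNReal * (Ioo 0 b).indicator 1 s
          + (Ici b).indicator f s) := by
          refine E.funNorm_mono ?_
          filter_upwards [ae_interval (α := ⊤)] with s hs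
          by_cases hsb : s < b
          · have : s ∈ Ioo 0 b := ⟨hs.1, hsb⟩
            simp [y, hsb, hs.1, ENNReal.coe_toNNReal hctop]
          · simp [y, hsb, not_lt.1 hsb]
      _ ≤ c.toNNReal * E.funNorm ((Ioo 0 b).indicator 1) + E.funNorm ((Ici b).indicator f) :=
          (E.funNorm_add_le _ _).trans (by gcongr; exact E.funNorm_mul_le _ _)
      _ ≤ ε / 4 + ε / 4 := by
          rw [← fundamental_eq, ENNReal.coe_toNNReal hctop, mul_comm]
          exact add_le_add h2 h1
  calc E.funNorm ((Ici b).indicator g)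
      = E.funNorm ((Ici b).indicator fun s => (fun r => g (r + b)) (s - b)) := by simp
    _ ≤ E.funNorm (fun s => g (s + b)) := funNorm_shift_le hE hg'.measurable hb.le
    _ ≤ 2 * E.funNorm y := hOC.funNorm_le_two_mul (Or.inr rfl) hE hy hg'
        (ne_top_of_le_ne_top hgE hg'le) hmaj
    _ ≤ 2 * (ε / 4 + ε / 4) := by gcongr
    _ = ε := by
        rw [← two_mul, ← mul_assoc, show (2 : ℝ≥0∞) * 2 = 4 by norm_num]
        exact ENNReal.mul_div_cancel (by simp) (by simp)

theorem exists_funNorm_tail_le (hα : α = 1 ∨ α = ⊤) (hE : E.IsSymmetric)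
    (hOC : E.OrderContinuous) {f : ℝ → ℝ≥0∞} (hf : Antitone f) (hfE : E.funNorm f ≠ ⊤)
    (hlim : α = ⊤ →
      Tendsto (fun s => E.fundamental s * ((∫⁻ r in Ioo 0 s, f r) / ENNReal.ofReal s))
        atTop (𝓝 0)) {ε : ℝ≥0∞} (hε : 0 < ε) :
    ∃ b : ℝ, 0 < b ∧ ∀ g : ℝ → ℝ≥0∞, Antitone g → E.funNorm g ≠ ⊤ →
      (∀ t, 0 < t → ∫⁻ s in Ioo 0 t, g s ≤ ∫⁻ s in Ioo 0 t, f s) →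
      E.funNorm ((Ici b).indicator g) ≤ ε := by
  rcases hα with rfl | rfl
  · refine ⟨1, one_pos, fun g _ _ _ => ?_⟩
    refine (E.funNorm_mono (g := fun _ => 0) ?_).trans (E.funNorm_zero.trans_le zero_le)
    filter_upwards [ae_interval (α := 1)] with s hs
    have : s ∉ Ici (1 : ℝ) := by simpa using hs.2
    simp [indicator_of_notMem this]
  · exact exists_funNorm_tail_le_of_top hE hOC hf hfE (hlim rfl) hε

theorem OrderContinuous.kOrderContinuous (hα : α = 1 ∨ α = ⊤) (hE : E.IsSymmetric)
    (hOC : E.OrderContinuous)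
    (hlim : α = ⊤ → ∀ x : E.carrier,
      Tendsto (fun s : ℝ => E.fundamental s * maximal (x : L0 α) s) atTop (𝓝 0)) :
    E.KOrderContinuous := by
  intro x u hux hu
  have hα0 : α ≠ 0 := by rcases hα with rfl | rfl <;> simp
  set f : ℝ → ℝ≥0∞ := rearrangement (x : L0 α)
  set g : ℕ → ℝ → ℝ≥0∞ := fun n => rearrangement (u n : L0 α)
  have hf : Antitone f := decr_antitone _
  have hg : ∀ n, Antitone (g n) := fun n => decr_antitone _
  have hfE : E.funNorm f ≠ ⊤ := by
    rw [funNorm_rearrangement hE]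
    exact enorm_ne_top
  have hgE : ∀ n, E.funNorm (g n) ≠ ⊤ := fun n => by
    rw [funNorm_rearrangement hE]
    exact enorm_ne_top
  have hgf : ∀ n t, 0 < t → ∫⁻ s in Ioo 0 t, g n s ≤ ∫⁻ s in Ioo 0 t, f s :=
    fun n t ht => lintegral_rearrangement_le_of_HLP (hux n) ht
  -- Monotonicity upgrades a.e. convergence to every `a > 0`: some point to the left of `a` is a
  -- convergence point, since `φ(a) ≠ 0` prevents `(0,a)` from being null in the interval.
  have hpt : ∀ a : ℝ, 0 < a → Tendsto (fun n => g n a) atTop (𝓝 0) := by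
    intro a ha
    obtain ⟨t, hta, ht⟩ : ∃ t < a, Tendsto (fun n => g n t) atTop (𝓝 0) := by
      by_contra! hcon
      refine fundamental_ne_zero (E := E) hα0 ha ?_
      rw [fundamental_eq]
      refine le_antisymm ((E.funNorm_mono (g := fun _ => 0) ?_).trans_eq E.funNorm_zero) zero_le
      filter_upwards [hu] with s hs
      have : s ∉ Ioo 0 a := fun hsa => hcon s hsa.2 hs
      rw [indicator_of_notMem this]
    exact tendsto_of_tendsto_of_tendsto_of_le_of_le tendsto_const_nhds ht (fun _ => zero_le)
      fun n => hg n hta.le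
  rw [← tendsto_enorm_zero_iff, ENNReal.tendsto_nhds_zero]
  intro ε hε
  have hε4 : 0 < ε / 4 := ENNReal.div_pos hε.ne' (by simp)
  obtain ⟨b, hb, htail⟩ := exists_funNorm_tail_le hα hE hOC hf hfE (fun h => hlim h x) hε4
  obtain ⟨a, ha, hhead⟩ : ∃ a : ℝ, 0 < a ∧ E.funNorm ((Iio a).indicator f) ≤ ε / 4 := by
    have := hOC.tendsto_funNorm_indicator hfE (A := fun n : ℕ => Iio (1 / (n + 1 : ℝ)))
      (fun n => measurableSet_Iio) (by
        filter_upwards [ae_interval (α := α)] with s hs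
        filter_upwards [tendsto_one_div_add_atTop_nhds_zero_nat.eventually_lt_const hs.1]
          with n hn
        simpa using hn.le)
    obtain ⟨n, hn⟩ := (ENNReal.tendsto_nhds_zero.1 this _ hε4).exists
    exact ⟨_, by positivity, hn⟩
  have hanti : ∀ {k : ℝ → ℝ≥0∞}, Antitone k → Antitone ((Iio a).indicator k) :=
    fun {k} hk s t hst => by
      by_cases ht : t ∈ Iio a
      · have hs : s ∈ Iio a := lt_of_le_of_lt hst ht
        rw [indicator_of_mem ht, indicator_of_mem hs]
        exact hk hst
      · rw [indicator_of_notMem ht]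
        exact zero_le
  have hhead_g : ∀ n, E.funNorm ((Iio a).indicator (g n)) ≤ 2 * (ε / 4) := fun n => by
    refine (hOC.funNorm_le_two_mul hα hE (hanti hf) (hanti (hg n)) ?_ fun t ht => ?_).trans
      (by gcongr)
    · exact ne_top_of_le_ne_top (hgE n)
        (E.funNorm_mono (Eventually.of_forall fun s => indicator_le_self _ _ s))
    · rw [setLIntegral_indicator measurableSet_Iio, setLIntegral_indicator measurableSet_Iio]
      -- Cutting both functions at the same point preserves majorization: the integrals up to `t`
      -- become integrals up to `min a t`.
      have : Iio a ∩ Ioo 0 t = Ioo 0 (min a t) := by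
        ext s
        simp only [mem_inter_iff, mem_Iio, mem_Ioo, lt_min_iff]
        tauto
      rw [this]
      exact hgf n _ (lt_min ha ht)
  have hmid : Tendsto (fun n => g n a * E.fundamental b) atTop (𝓝 0) := by
    have := ENNReal.Tendsto.mul_const (b := E.fundamental b) (hpt a ha)
      (Or.inr (fundamental_ne_top hE hα0 b))
    rwa [zero_mul] at this
  filter_upwards [ENNReal.tendsto_nhds_zero.1 hmid _ hε4,
    (hpt a ha).eventually_lt_const ENNReal.zero_lt_top] with n hn hna
  calc ‖u n‖ₑ = E.funNorm (g n) := (funNorm_rearrangement hE (u n)).symm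
    _ ≤ E.funNorm (fun s => (Iio a).indicator (g n) s
        + ((g n a).toNNReal * (Ioo 0 b).indicator 1 s + (Ici b).indicator (g n) s)) := by
        refine E.funNorm_mono ?_
        filter_upwards [ae_interval (α := α)] with s hs
        by_cases hsa : s < a
        · rw [indicator_of_mem (show s ∈ Iio a from hsa)]
          exact le_self_add
        refine le_trans ?_ le_add_self
        by_cases hsb : s < b
        · rw [indicator_of_mem (show s ∈ Ioo 0 b from ⟨hs.1, hsb⟩), Pi.one_apply, mul_one,
            ENNReal.coe_toNNReal hna.ne]
          exact (hg n (not_lt.1 hsa)).trans le_self_add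
        · rw [indicator_of_mem (s := Ici b) (not_lt.1 hsb)]
          exact le_add_self
    _ ≤ E.funNorm ((Iio a).indicator (g n)) + ((g n a).toNNReal * E.funNorm ((Ioo 0 b).indicator 1)
        + E.funNorm ((Ici b).indicator (g n))) := by
        refine (E.funNorm_add_le _ _).trans ?_
        gcongr
        refine (E.funNorm_add_le _ _).trans ?_
        gcongr
        exact E.funNorm_mul_le _ _
    _ ≤ 2 * (ε / 4) + (ε / 4 + ε / 4) := by
        rw [← fundamental_eq, ENNReal.coe_toNNReal hna.ne]
        exact add_le_add (hhead_g n) (add_le_add hn (htail _ (hg n) (hgE n) (hgf n)))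
    _ = ε := by
        rw [← two_mul, ← two_mul, ← mul_assoc, show (2 : ℝ≥0∞) * 2 = 4 by norm_num]
        exact ENNReal.mul_div_cancel (by simp) (by simp)

theorem tendsto_rearrangement_of_tendsto_fundamental_mul_maximal {E : BanachFunctionSpace ⊤}
    (x : E.carrier)
    (hlim : Tendsto (fun s : ℝ => E.fundamental s * maximal (x : L0 ⊤) s) atTop (𝓝 0)) :
    Tendsto (fun t : ℝ => rearrangement (x : L0 ⊤) t) atTop (𝓝 0) := by
  have h1 : E.fundamental 1 ≠ 0 := fundamental_ne_zero (by simp) one_pos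
  -- A finite positive `r` below `φ(1)` can be cancelled, and `φ(s) > r` for all `s ≥ 1`.
  obtain ⟨r, hr0, hr⟩ := ENNReal.lt_iff_exists_nnreal_btwn.1 (pos_iff_ne_zero.2 h1)
  rw [ENNReal.tendsto_nhds_zero] at hlim ⊢
  intro ε hε
  filter_upwards [hlim (r * ε) (ENNReal.mul_pos hr0.ne' hε.ne'), eventually_ge_atTop 1]
    with s hs hs1
  have hs0 : ENNReal.ofReal s ≠ 0 := by
    simpa using zero_lt_one.trans_le hs1
  calc rearrangement (x : L0 ⊤) s ≤ maximal (x : L0 ⊤) s := by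
        rw [maximal, ENNReal.le_div_iff_mul_le (Or.inl hs0) (Or.inl ENNReal.ofReal_ne_top),
          mul_comm]
        exact ofReal_mul_le_lintegral (decr_antitone _) s
    _ ≤ ε := by
        refine (ENNReal.mul_le_mul_iff_right (a := (r : ℝ≥0∞)) hr0.ne' ENNReal.coe_ne_top).1 ?_
        refine le_trans ?_ hs
        gcongr
        exact hr.le.trans (fundamental_mono hs1)

end BanachFunctionSpace

/-! ### From `K`-order continuity to order continuity and decay of `φ x**` -/

theorem HLP_of_lintegral_le {x y : L0 α} (h : ∀ t, 0 < t →
    ∫⁻ s in Ioo 0 t, rearrangement x s ≤ ∫⁻ s in Ioo 0 t, rearrangement y s) : HLP x y :=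
  fun t ht => ENNReal.div_le_div_right (h t ht) _

theorem HLP_of_ae_le {x y : L0 α}
    (h : (fun s => ‖x s‖ₑ) ≤ᵐ[intervalMeasure α] fun s => ‖y s‖ₑ) : HLP x y :=
  HLP_of_lintegral_le fun _ _ => lintegral_mono fun s => decr_mono (distr_mono h) s

theorem distribution_ne_top (hα : α = 1 ∨ α = ⊤) (x : L0 α)
    (hx : α = ⊤ → Tendsto (fun t : ℝ => rearrangement x t) atTop (𝓝 0)) {l : ℝ≥0∞} (hl : 0 < l) :
    distribution x l ≠ ⊤ := by
  rcases hα with rfl | rfl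
  · exact ne_top_of_le_ne_top ENNReal.one_ne_top (distr_le _ l)
  · obtain ⟨t, ht⟩ := (ENNReal.tendsto_nhds_zero.1 (hx rfl) l hl).exists
    exact ne_top_of_le_ne_top ENNReal.ofReal_ne_top ((decr_le_iff _ l t).1 ht)

/-- All the sets where `|u n| > l` lie, up to null sets, in the finite-measure set where `|x| > l`;
there a.e. convergence implies convergence in measure. -/
theorem tendsto_distribution_of_dominated {x : L0 α} {u : ℕ → L0 α}
    (hux : ∀ n, (fun s => ‖u n s‖ₑ) ≤ᵐ[intervalMeasure α] fun s => ‖x s‖ₑ)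
    (hu : ∀ᵐ s ∂(intervalMeasure α), Tendsto (fun n => u n s) atTop (𝓝 0)) {l : ℝ≥0∞}
    (hl : 0 < l) (hx : distribution x l ≠ ⊤) :
    Tendsto (fun n => distribution (u n) l) atTop (𝓝 0) := by
  set S : Set ℝ := {s | l < ‖x s‖ₑ}
  have hS : MeasurableSet S := measurableSet_lt measurable_const (measurable_enorm_coe x)
  have : IsFiniteMeasure ((intervalMeasure α).restrict S) :=
    ⟨by rw [Measure.restrict_apply_univ]; exact lt_top_iff_ne_top.2 hx⟩
  have hT : TendstoInMeasure ((intervalMeasure α).restrict S) (fun n => (u n : ℝ → ℝ)) atTop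
      (fun _ => 0) :=
    tendstoInMeasure_of_tendsto_ae (fun n => (u n).measurable.aestronglyMeasurable)
      (ae_restrict_of_ae hu)
  refine tendsto_of_tendsto_of_tendsto_of_le_of_le tendsto_const_nhds (hT l hl)
    (fun _ => zero_le) fun n => ?_
  have hm : MeasurableSet {s | l ≤ edist (u n s) 0} :=
    measurableSet_le measurable_const ((u n).measurable.edist measurable_const)
  rw [Measure.restrict_apply hm]
  refine measure_mono_ae ?_
  filter_upwards [hux n] with s hs hls
  refine ⟨?_, lt_of_lt_of_le hls hs⟩
  change l ≤ edist (u n s) 0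
  rw [edist_zero_right]
  exact le_of_lt hls

theorem decr_const_mul_indicator_Ioo_le (c : ℝ≥0∞) (b : ℝ) (t : ℝ) :
    decr α (fun s => c * (Ioo 0 b).indicator 1 s) t ≤ (Iio b).indicator (fun _ => c) t := by
  rw [decr_le_iff]
  by_cases ht : t < b
  · have : {s | c < c * (Ioo 0 b).indicator (1 : ℝ → ℝ≥0∞) s} = ∅ := by
      ext s
      by_cases hs : s ∈ Ioo 0 b <;> simp [indicator_of_mem, indicator_of_notMem, hs]
    rw [indicator_of_mem (show t ∈ Iio b from ht), distr, this, measure_empty]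
    exact zero_le
  · rw [indicator_of_notMem (show t ∉ Iio b from ht)]
    calc distr α (fun s => c * (Ioo 0 b).indicator 1 s) 0 ≤ intervalMeasure α (Ioo 0 b) := by
          refine measure_mono fun s hs => ?_
          by_contra hsb
          simp [indicator_of_notMem hsb] at hs
      _ ≤ volume (Ioo 0 b) := Measure.restrict_apply_le _ _
      _ ≤ ENNReal.ofReal t := by
          rw [Real.volume_Ioo, sub_zero]
          exact ENNReal.ofReal_le_ofReal (not_lt.1 ht)

/-- This gives `f**(b) χ_(0,b) ≺ f`. For `t < b` it says that averages decrease, which follows from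
`∫_t^b f ≤ (b - t) f(t)` and `t f(t) ≤ ∫_0^t f`. -/
theorem average_mul_le_lintegral {f : ℝ → ℝ≥0∞} (hf : Antitone f) {b t : ℝ} (hb : 0 < b)
    (ht : 0 < t) :
    ((∫⁻ s in Ioo 0 b, f s) / ENNReal.ofReal b) * ENNReal.ofReal (min t b)
      ≤ ∫⁻ s in Ioo 0 t, f s := by
  have hb0 : ENNReal.ofReal b ≠ 0 := by simpa using hb
  rcases le_or_gt b t with hbt | htb
  · rw [min_eq_right hbt, ENNReal.div_mul_cancel hb0 ENNReal.ofReal_ne_top]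
    exact lintegral_mono_set (Ioo_subset_Ioo_right hbt)
  · rw [min_eq_left htb.le, ← ENNReal.mul_div_right_comm]
    refine ENNReal.div_le_of_le_mul ?_
    have hsplit : ∫⁻ s in Ioo 0 b, f s = (∫⁻ s in Ioo 0 t, f s) + ∫⁻ s in Ico t b, f s := by
      rw [← Ioo_union_Ico_eq_Ioo ht htb.le, lintegral_union measurableSet_Ico]
      exact Set.disjoint_left.2 fun s h1 h2 => absurd h1.2 (not_lt.2 h2.1)
    have h2 : ∫⁻ s in Ico t b, f s ≤ ENNReal.ofReal (b - t) * f t := by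
      calc ∫⁻ s in Ico t b, f s ≤ ∫⁻ _ in Ico t b, f t :=
            setLIntegral_mono measurable_const fun s hs => hf hs.1
        _ = _ := by simp [mul_comm]
    calc (∫⁻ s in Ioo 0 b, f s) * ENNReal.ofReal t
        ≤ ((∫⁻ s in Ioo 0 t, f s) + ENNReal.ofReal (b - t) * f t) * ENNReal.ofReal t := by
          rw [hsplit]
          gcongr
      _ = (∫⁻ s in Ioo 0 t, f s) * ENNReal.ofReal t
          + ENNReal.ofReal (b - t) * (ENNReal.ofReal t * f t) := by ring
      _ ≤ (∫⁻ s in Ioo 0 t, f s) * ENNReal.ofReal t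
          + ENNReal.ofReal (b - t) * ∫⁻ s in Ioo 0 t, f s := by
          gcongr
          exact BanachFunctionSpace.ofReal_mul_le_lintegral hf t
      _ = (∫⁻ s in Ioo 0 t, f s) * ENNReal.ofReal b := by
          rw [mul_comm (ENNReal.ofReal (b - t)), ← mul_add,
            ← ENNReal.ofReal_add ht.le (sub_nonneg.2 htb.le)]
          congr 2
          ring

theorem tendsto_average {f : ℝ → ℝ≥0∞} (hf : Antitone f)
    (hfin : ∀ t, 0 < t → ∫⁻ s in Ioo 0 t, f s ≠ ⊤) (h0 : Tendsto f atTop (𝓝 0)) :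
    Tendsto (fun t => (∫⁻ s in Ioo 0 t, f s) / ENNReal.ofReal t) atTop (𝓝 0) := by
  rw [ENNReal.tendsto_nhds_zero]
  intro ε hε
  have hε2 : 0 < ε / 2 := ENNReal.div_pos hε.ne' (by simp)
  obtain ⟨T, hT, hT0⟩ := ((ENNReal.tendsto_nhds_zero.1 h0 _ hε2).and
    (eventually_gt_atTop 0)).exists
  have h1 : Tendsto (fun t => (∫⁻ s in Ioo 0 T, f s) / ENNReal.ofReal t) atTop (𝓝 0) := by
    have := ENNReal.Tendsto.const_div (a := ∫⁻ s in Ioo 0 T, f s)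
      (ENNReal.tendsto_ofReal_atTop) (Or.inr (hfin T hT0))
    rwa [ENNReal.div_top] at this
  filter_upwards [ENNReal.tendsto_nhds_zero.1 h1 _ hε2, eventually_gt_atTop T] with t ht htT
  have ht0 : ENNReal.ofReal t ≠ 0 := by simpa using hT0.trans htT
  have hsplit : ∫⁻ s in Ioo 0 t, f s = (∫⁻ s in Ioo 0 T, f s) + ∫⁻ s in Ico T t, f s := by
    rw [← Ioo_union_Ico_eq_Ioo hT0 htT.le, lintegral_union measurableSet_Ico]
    exact Set.disjoint_left.2 fun s h1 h2 => absurd h1.2 (not_lt.2 h2.1)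
  have h2 : ∫⁻ s in Ico T t, f s ≤ ε / 2 * ENNReal.ofReal t := by
    calc ∫⁻ s in Ico T t, f s ≤ ∫⁻ _ in Ico T t, ε / 2 :=
          setLIntegral_mono measurable_const fun s hs => (hf hs.1).trans hT
      _ = ε / 2 * ENNReal.ofReal (t - T) := by simp
      _ ≤ _ := by
          gcongr
          linarith
  rw [hsplit, ENNReal.add_div]
  calc _ ≤ ε / 2 + ε / 2 := add_le_add ht (ENNReal.div_le_of_le_mul h2)
    _ = ε := ENNReal.add_halves ε

namespace BanachFunctionSpace

variable {E : BanachFunctionSpace α}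

theorem KOrderContinuous.orderContinuous (hα : α = 1 ∨ α = ⊤) (hK : E.KOrderContinuous)
    (hlim : α = ⊤ → ∀ x : E.carrier,
      Tendsto (fun t : ℝ => rearrangement (x : L0 α) t) atTop (𝓝 0)) :
    E.OrderContinuous := by
  intro x u hu0 hux hu
  have hle : ∀ n, (fun s => ‖(u n : L0 α) s‖ₑ) ≤ᵐ[intervalMeasure α]
      fun s => ‖(x : L0 α) s‖ₑ := fun n => by
    have h1 := AEEqFun.coeFn_le.2 (hu0 n)
    have h2 := AEEqFun.coeFn_le.2 (hux n)
    filter_upwards [h1, h2, AEEqFun.coeFn_zero (μ := intervalMeasure α) (β := ℝ),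
      AEEqFun.coeFn_abs (x : L0 α)] with s h1 h2 h3 h4
    rw [h3] at h1
    rw [h4] at h2
    rw [enorm_le_iff_norm_le, Real.norm_eq_abs, abs_of_nonneg h1]
    exact h2
  refine hK x u (fun n => HLP_of_ae_le (hle n)) ?_
  filter_upwards [ae_interval (α := α)] with t ht
  rw [ENNReal.tendsto_nhds_zero]
  intro ε hε
  have hd := tendsto_distribution_of_dominated hle hu hε
    (distribution_ne_top hα _ (fun h => hlim h x) hε)
  have ht0 : (0 : ℝ≥0∞) < ENNReal.ofReal t := by simpa using ht.1
  filter_upwards [ENNReal.tendsto_nhds_zero.1 hd _ ht0] with n hn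
  exact (decr_le_iff _ ε t).2 hn

theorem KOrderContinuous.tendsto_fundamental_mul_maximal {E : BanachFunctionSpace ⊤}
    (hE : E.IsSymmetric) (hK : E.KOrderContinuous) (x : E.carrier)
    (hx : Tendsto (fun t : ℝ => rearrangement (x : L0 ⊤) t) atTop (𝓝 0)) :
    Tendsto (fun s : ℝ => E.fundamental s * maximal (x : L0 ⊤) s) atTop (𝓝 0) := by
  set f : ℝ → ℝ≥0∞ := rearrangement (x : L0 ⊤)
  have hf : Antitone f := decr_antitone _
  have hfE : E.funNorm f ≠ ⊤ := by
    rw [funNorm_rearrangement hE]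
    exact enorm_ne_top
  have hfin : ∀ t, 0 < t → ∫⁻ s in Ioo 0 t, f s ≠ ⊤ := fun t ht =>
    lintegral_ne_top hE (by simp) hf hfE ht le_top
  refine tendsto_of_seq_tendsto fun r hr => ?_
  -- `K`-order continuity is sequential, so the limit is tested along a sequence `r`; the truncation
  -- at `1` keeps every term positive and changes only finitely many of them.
  let b : ℕ → ℝ := fun n => max (r n) 1
  have hb : ∀ n, 0 < b n := fun n => lt_max_of_lt_right one_pos
  have hbr : b =ᶠ[atTop] r := by
    filter_upwards [hr.eventually_ge_atTop 1] with n hn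
    exact max_eq_left hn
  have hbt : Tendsto b atTop atTop := hr.congr' hbr.symm
  let c : ℕ → ℝ≥0∞ := fun n => maximal (x : L0 ⊤) (b n)
  have hc : ∀ n, c n ≠ ⊤ := fun n =>
    ENNReal.div_ne_top (hfin _ (hb n)) (by simpa using hb n)
  let k : ℕ → ℝ → ℝ≥0∞ := fun n s => c n * (Ioo 0 (b n)).indicator 1 s
  have hk : ∀ n, Measurable (k n) := fun n =>
    (measurable_one.indicator measurableSet_Ioo).const_mul _
  have hkfin : ∀ n s, k n s ≠ ⊤ := fun n s => by
    by_cases hs : s ∈ Ioo 0 (b n)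
    · simpa [k, indicator_of_mem hs] using hc n
    · simp [k, indicator_of_notMem hs]
  have hcoe : ∀ n, (fun s => ‖ofFun ⊤ (k n) (hk n) s‖ₑ) =ᵐ[intervalMeasure ⊤] k n := fun n =>
    enorm_ofFun (hk n) (Eventually.of_forall (hkfin n))
  have hmem : ∀ n, ofFun ⊤ (k n) (hk n) ∈ E.carrier := fun n => by
    refine E.mem_of_funNorm_lt_top ((E.funNorm_mono (hcoe n).le).trans_lt ?_)
    have h1 := E.funNorm_mul_le (c n).toNNReal ((Ioo 0 (b n)).indicator 1)
    rw [ENNReal.coe_toNNReal (hc n), ← fundamental_eq] at h1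
    exact h1.trans_lt (ENNReal.mul_lt_top (lt_top_iff_ne_top.2 (hc n))
      (lt_top_iff_ne_top.2 (fundamental_ne_top hE (by simp) _)))
  have hdecr : ∀ n t, rearrangement (ofFun ⊤ (k n) (hk n)) t
      ≤ (Iio (b n)).indicator (fun _ => c n) t := fun n t => by
    rw [rearrangement_eq_decr]
    exact (decr_mono (distr_congr (hcoe n)).le t).trans (decr_const_mul_indicator_Ioo_le _ _ t)
  have hlim := hK x (fun n => ⟨_, hmem n⟩) (fun n => HLP_of_lintegral_le fun t ht => by
      calc ∫⁻ s in Ioo 0 t, rearrangement (ofFun ⊤ (k n) (hk n)) s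
          ≤ ∫⁻ s in Ioo 0 t, (Iio (b n)).indicator (fun _ => c n) s :=
            lintegral_mono fun s => hdecr n s
        _ = c n * ENNReal.ofReal (min t (b n)) := by
            have : Iio (b n) ∩ Ioo 0 t = Ioo 0 (min t (b n)) := by
              ext s
              simp only [mem_inter_iff, mem_Iio, mem_Ioo, lt_min_iff]
              tauto
            rw [setLIntegral_indicator measurableSet_Iio, this]
            simp
        _ ≤ ∫⁻ s in Ioo 0 t, f s := average_mul_le_lintegral hf (hb n) ht)
    (Eventually.of_forall fun t =>
      tendsto_of_tendsto_of_tendsto_of_le_of_le tendsto_const_nhds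
        ((tendsto_average hf hfin hx).comp hbt) (fun _ => zero_le)
        fun n => (hdecr n t).trans (indicator_le_self _ _ t))
  rw [← tendsto_enorm_zero_iff] at hlim
  have hle : Tendsto (fun n => E.fundamental (b n) * maximal (x : L0 ⊤) (b n)) atTop (𝓝 0) := by
    refine tendsto_of_tendsto_of_tendsto_of_le_of_le tendsto_const_nhds hlim
      (fun _ => zero_le) fun n => ?_
    calc E.fundamental (b n) * maximal (x : L0 ⊤) (b n)
        = c n * E.funNorm ((Ioo 0 (b n)).indicator 1) := by rw [mul_comm, fundamental_eq]
      _ ≤ E.funNorm (k n) := E.mul_funNorm_le _ _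
      _ ≤ ‖(⟨_, hmem n⟩ : E.carrier)‖ₑ := E.funNorm_le _ (hcoe n).symm.le
  refine hle.congr' ?_
  filter_upwards [hbr] with n hn
  rw [hn]
  rfl

end BanachFunctionSpace

end SymmetricSpace

end

theorem mainTheorem2 (α : ℝ≥0∞) (hα : α = 1 ∨ α = ⊤)
    (E : SymmetricSpace.BanachFunctionSpace α) (hE : E.IsSymmetric) :
    (E.OrderContinuous ∧
      (α = ⊤ → ∀ x : E.carrier,
        Tendsto (fun s : ℝ => E.fundamental s * SymmetricSpace.maximal (x : SymmetricSpace.L0 α) s)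
          atTop (𝓝 0))) ↔
    (E.KOrderContinuous ∧
      (α = ⊤ → ∀ x : E.carrier,
        Tendsto (fun t : ℝ => SymmetricSpace.rearrangement (x : SymmetricSpace.L0 α) t)
          atTop (𝓝 0))) := by
  constructor
  · rintro ⟨hOC, hlim⟩
    refine ⟨hOC.kOrderContinuous hα hE hlim, ?_⟩
    rintro rfl x
    exact SymmetricSpace.BanachFunctionSpace.tendsto_rearrangement_of_tendsto_fundamental_mul_maximal
      x (hlim rfl x)
  · rintro ⟨hK, hlim⟩
    refine ⟨hK.orderContinuous hα hlim, ?_⟩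
    rintro rfl x
    exact hK.tendsto_fundamental_mul_maximal hE x (hlim rfl x)
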